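/- Let $D$ be a finite abelian group and $b:D\times D\to\mathbb{Q}/\mathbb{Z}$ a symmetric non-degenerate bilinear form. For a prime $p$ let $D_p$ be the $p$-primary subgroup of $D$, and for $k\ge 1$ let $d_p^k$ be the number of summands $\mathbb{Z}/p^k$ in a decomposition $D_p\cong\bigoplus_{k\ge1}(\mathbb{Z}/p^k)^{d_p^k}$. For $k\ge 0$ put $G_k=\{x\in D\mid 2^kx=0\}$. For $k\geq 1$ put $\rho_k=G_k/(G_{k-1}+2G_{k+1})$, with the induced form $\rho_k(b)(\bar x,\bar y)=2^{k-1}b(x,y)$. If $\rho_k(b)$ is not alternating, i.e. $\rho_k(b)(u,u)\ne0$ for some $u\in\rho_k$, set $\sigma_k(b)=\infty$. Otherwise $q_k(\bar x)=2^{k-1}b(x,x)\in\mathbb{Q}/\mathbb{Z}$ is a well-defined function on the quotient group $D_2/G_k$, the normalized Gauss sum $$S_k(b)=|D_2/G_k|^{-1/2}\sum_{\bar x\in D_2/G_k}e^{2\pi i\,q_k(\bar x)}$$ is an eighth root of unity, and $\sigma_k(b)\in\mathbb{Z}/8$ is defined by $S_k(b)=e^{2\pi i\,\sigma_k(b)/8}$.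 (These $\sigma_k(b)\in\mathbb{Z}/8\cup\{\infty\}$ are the Kawauchi–Kojima signature invariants.) Then there is an automorphism $f$ of $D$ with $b(f(x),f(y))=-b(x,y)$ for all $x,y\in D$, i.e. $(D,b)\cong(D,-b)$, if and only if both of the following hold: 1. for every prime $p\equiv 3\pmod 4$ and every $k\ge1$, the rank $d_p^k$ is even; 2. for every $k\ge1$, $\sigma_k(b)\in\{0,4,\infty\}$. -/

import Mathlib

/-! ### Homogeneous ranks -/

/-- The `p`-primary component of a finite abelian group is a finite direct sum of homogeneous
groups `(ℤ/p^k)^(d k)` with `k ≥ 1`. -/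
theorem exists_homogeneous_decomposition (D : Type*) [AddCommGroup D] [Finite D]
    (p : ℕ) [hp : Fact p.Prime] :
    ∃ d : ℕ →₀ ℕ, d 0 = 0 ∧ Nonempty (AddCommGroup.primaryComponent D p ≃+
      ((k : d.support) → Fin (d k) → ZMod (p ^ (k : ℕ)))) := by
  classical
  obtain ⟨ι, _, q, hq, e, ⟨f⟩⟩ :=
    AddCommGroup.equiv_directSum_zmod_of_finite (AddCommGroup.primaryComponent D p)
  have hqe : ∀ i, q i ^ e i = p ^ e i := by
    intro i
    rcases Nat.eq_zero_or_pos (e i) with h0 | h0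
    · simp [h0]
    · obtain ⟨x, hx⟩ := f.surjective (DirectSum.of (fun i => ZMod (q i ^ e i)) i 1)
      obtain ⟨n, hn⟩ := x.2
      have h1 : p ^ n • x = 0 := Subtype.ext (by simpa using hn)
      have h2 : (DirectSum.of (fun i => ZMod (q i ^ e i)) i) (p ^ n • 1) = 0 := by
        rw [map_nsmul, ← hx, ← map_nsmul, h1, map_zero]
      have h3 : ((p ^ n : ℕ) : ZMod (q i ^ e i)) = 0 := by
        have := DirectSum.of_injective i (h2.trans (map_zero _).symm)
        simpa using this
      rw [ZMod.natCast_eq_zero_iff] at h3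
      have h4 : q i ∣ p ^ n := (dvd_pow_self _ h0.ne').trans h3
      rw [(Nat.prime_dvd_prime_iff_eq (hq i) hp.out).1 ((hq i).dvd_of_dvd_pow h4)]
  let d : ℕ →₀ ℕ := Finsupp.onFinset (Finset.univ.image e)
    (fun k => if k = 0 then 0 else Fintype.card {i // e i = k}) (by
      intro k hk
      have hk' : k ≠ 0 ∧ Fintype.card {i // e i = k} ≠ 0 := by
        by_cases h : k = 0
        · simp [h] at hk
        · rw [if_neg h] at hk; exact ⟨h, hk⟩
      obtain ⟨i, hi⟩ := Fintype.card_pos_iff.1 (Nat.pos_of_ne_zero hk'.2)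
      exact Finset.mem_image.2 ⟨i, Finset.mem_univ _, hi⟩)
  have hd0 : d 0 = 0 := by simp [d]
  have hd : ∀ k : d.support, d k = Fintype.card {i // e i = k} := by
    intro k
    have : (k : ℕ) ≠ 0 := by
      intro h
      have := Finsupp.mem_support_iff.1 k.2
      rw [h] at this
      exact this hd0
    simp [d, this]
  have hs : ∀ i, e i ≠ 0 → e i ∈ d.support := by
    intro i hi
    rw [Finsupp.mem_support_iff]
    simp only [d, Finsupp.onFinset_apply, if_neg hi]
    exact (Fintype.card_pos_iff.2 ⟨⟨i, rfl⟩⟩).ne'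
  let ε : ∀ k : d.support, Fin (d k) ≃ {i // e i = k} := fun k =>
    (finCongr (hd k)).trans (Fintype.equivFin _).symm
  let c : ∀ {a b : ℕ}, a = b → (ZMod (p ^ a) ≃+* ZMod (p ^ b)) := fun h =>
    ZMod.ringEquivCongr (congrArg (p ^ ·) h)
  have hc : ∀ (a : ℕ) (x : ZMod (p ^ a)), c (rfl : a = a) x = x := by
    intro a x
    simp [c, ZMod.ringEquivCongr_refl]
  let g : (∀ i, ZMod (p ^ e i)) →+ ((k : d.support) → Fin (d k) → ZMod (p ^ (k : ℕ))) :=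
    { toFun := fun x k j => c (ε k j).2 (x (ε k j).1)
      map_zero' := by ext; simp
      map_add' := by intros; ext; simp }
  have hgx : ∀ (x : ∀ i, ZMod (p ^ e i)) (k : d.support) (j : Fin (d k)) (i : ι)
      (hi : e i = k), ε k j = ⟨i, hi⟩ → g x k j = c hi (x i) := by
    intro x k j i hi h
    change c (ε k j).2 (x (ε k j).1) = _
    generalize ε k j = t at h
    subst h
    rfl
  have hg : Function.Bijective g := by
    constructor
    · rw [injective_iff_map_eq_zero]
      intro x hx
      ext i
      by_cases hi : e i = 0
      · have : Subsingleton (ZMod (p ^ e i)) := by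
          rw [hi, pow_zero]; infer_instance
        exact Subsingleton.elim _ _
      · obtain ⟨j, hj⟩ := (ε ⟨e i, hs i hi⟩).surjective ⟨i, rfl⟩
        have h := hgx x _ j i rfl hj
        rw [hx] at h
        exact (hc _ (x i)).symm.trans h.symm
    · intro y
      refine ⟨fun i => if hi : e i ≠ 0 then
        y ⟨e i, hs i hi⟩ ((ε ⟨e i, hs i hi⟩).symm ⟨i, rfl⟩) else 0, ?_⟩
      funext k j
      obtain ⟨⟨i, hi⟩, hj⟩ : ∃ i, ε k j = i := ⟨_, rfl⟩
      rw [hgx _ k j i hi hj]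
      obtain ⟨k, hk⟩ := k
      simp only at hi
      subst hi
      have : e i ≠ 0 := by
        intro h
        have := Finsupp.mem_support_iff.1 hk
        rw [h] at this
        exact this hd0
      rw [dif_pos this, ← hj, Equiv.symm_apply_apply]
      exact hc _ _
  refine ⟨d, hd0, ⟨f.trans (AddEquiv.trans (DirectSum.addEquivProd _)
    (AddEquiv.trans (AddEquiv.piCongrRight fun i => (ZMod.ringEquivCongr (hqe i)).toAddEquiv)
      (AddEquiv.ofBijective g hg)))⟩⟩


theorem card_torsion_pi {ι : Type*} [Fintype ι] (A : ι → Type*) [∀ i, AddCommGroup (A i)]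
    (n : ℕ) : Nat.card {x : ∀ i, A i // n • x = 0} = ∏ i, Nat.card {x : A i // n • x = 0} := by
  rw [← Nat.card_pi, ← Nat.card_congr (Equiv.subtypePiEquivPi (p := fun i (x : A i) => n • x = 0))]
  exact Nat.card_congr (Equiv.subtypeEquivRight fun x => by simp [funext_iff])

theorem card_torsion_decomposition (p : ℕ) [hp : Fact p.Prime] (d : ℕ →₀ ℕ) (n : ℕ) :
    Nat.card {x : (k : d.support) → Fin (d k) → ZMod (p ^ (k : ℕ)) // p ^ n • x = 0} =
      p ^ d.sum fun k m => m * min k n := by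
  have hz : ∀ k : ℕ, Nat.card {x : ZMod (p ^ k) // p ^ n • x = 0} = p ^ min k n := by
    intro k
    have h := IsAddCyclic.card_nsmulAddMonoidHom_ker (G := ZMod (p ^ k)) (p ^ n)
    rw [Nat.card_zmod] at h
    have h2 : (p ^ k).gcd (p ^ n) = p ^ min k n := by
      rcases le_total k n with hkn | hkn
      · rw [min_eq_left hkn, Nat.gcd_eq_left (pow_dvd_pow p hkn)]
      · rw [min_eq_right hkn, Nat.gcd_eq_right (pow_dvd_pow p hkn)]
    rw [← h2, ← h]
    rfl
  rw [card_torsion_pi]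
  simp only [card_torsion_pi, hz, Finset.prod_const, Finset.card_univ, Fintype.card_fin]
  rw [Finsupp.sum, ← Finset.prod_pow_eq_pow_sum, ← Finset.prod_coe_sort d.support]
  refine Finset.prod_congr rfl fun k _ => ?_
  rw [← pow_mul, mul_comm]

theorem homogeneous_decomposition_unique (D : Type*) [AddCommGroup D] (p : ℕ)
    [hp : Fact p.Prime] (d d' : ℕ →₀ ℕ)
    (f : AddCommGroup.primaryComponent D p ≃+
      ((k : d.support) → Fin (d k) → ZMod (p ^ (k : ℕ))))
    (f' : AddCommGroup.primaryComponent D p ≃+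
      ((k : d'.support) → Fin (d' k) → ZMod (p ^ (k : ℕ))))
    (k : ℕ) (hk : 1 ≤ k) : d k = d' k := by
  let φ : (ℕ →₀ ℕ) → ℕ → ℕ := fun d n => d.sum fun k m => m * min k n
  have hφ : ∀ n, φ d n = φ d' n := by
    intro n
    apply Nat.pow_right_injective hp.out.two_le
    change p ^ φ d n = p ^ φ d' n
    rw [← card_torsion_decomposition, ← card_torsion_decomposition]
    exact Nat.card_congr ((f.symm.trans f').toEquiv.subtypeEquiv fun x => by
      rw [← map_eq_zero_iff (f.symm.trans f') (AddEquiv.injective _), map_nsmul]; rfl)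
  have key : ∀ d : ℕ →₀ ℕ, 2 * φ d k = φ d (k - 1) + φ d (k + 1) + d k := by
    intro d
    simp only [φ, Finsupp.sum]
    have h : d k = ∑ i ∈ d.support, if i = k then d i else 0 := by
      simp
    rw [h, Finset.mul_sum, ← Finset.sum_add_distrib, ← Finset.sum_add_distrib]
    refine Finset.sum_congr rfl fun i _ => ?_
    have : 2 * min i k = min i (k - 1) + min i (k + 1) + if i = k then 1 else 0 := by
      split_ifs <;> omega
    calc 2 * (d i * min i k) = d i * (2 * min i k) := by ring
      _ = _ := by rw [this]; split_ifs <;> ring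
  have h1 := key d
  have h2 := key d'
  rw [hφ, hφ, hφ] at h1
  omega

/-- The homogeneous rank `d_p^k` of a finite abelian group `D`: the number of summands `ℤ/p^k` in
a decomposition of the `p`-primary component of `D` as `⨁ k, (ℤ/p^k)^(d_p^k)`, `k ≥ 1`. -/
noncomputable def homogeneousRank (D : Type*) [AddCommGroup D] [Finite D] (p : ℕ)
    [Fact p.Prime] (k : ℕ) : ℕ :=
  (exists_homogeneous_decomposition D p).choose k

/-- The homogeneous rank does not depend on the decomposition. -/
theorem homogeneousRank_eq (D : Type*) [AddCommGroup D] [Finite D] (p : ℕ) [Fact p.Prime]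
    (d : ℕ →₀ ℕ) (f : AddCommGroup.primaryComponent D p ≃+
      ((k : d.support) → Fin (d k) → ZMod (p ^ (k : ℕ)))) (k : ℕ) (hk : 1 ≤ k) :
    homogeneousRank D p k = d k :=
  homogeneous_decomposition_unique D p _ d
    (exists_homogeneous_decomposition D p).choose_spec.2.some f k hk

/-! ### Gauss sums of quadratic functions with values in `ℚ/ℤ` -/

/-- The map `ℚ/ℤ → ℂ`, `t ↦ exp (2πi t)`. -/
noncomputable def expQZ (t : AddCircle (1 : ℚ)) : ℂ :=
  AddCircle.toCircle (T := (1 : ℝ))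
    (QuotientAddGroup.map (AddSubgroup.zmultiples (1 : ℚ)) (AddSubgroup.zmultiples (1 : ℝ))
      (Rat.castHom ℝ : ℚ →+ ℝ) (by simp [AddSubgroup.zmultiples_le]) t)

theorem expQZ_coe (r : ℚ) :
    expQZ (r : AddCircle (1 : ℚ)) = Complex.exp (2 * Real.pi * Complex.I * r) := by
  have : expQZ (r : AddCircle (1 : ℚ)) =
      AddCircle.toCircle (T := (1 : ℝ)) ((r : ℝ) : AddCircle (1 : ℝ)) := rfl
  rw [this, AddCircle.toCircle_apply_mk, Circle.coe_exp]
  congr 1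
  push_cast
  ring

theorem expQZ_add (s t : AddCircle (1 : ℚ)) : expQZ (s + t) = expQZ s * expQZ t := by
  simp [expQZ, AddCircle.toCircle_add]

theorem expQZ_zero : expQZ 0 = 1 := by simp [expQZ]

theorem expQZ_neg (t : AddCircle (1 : ℚ)) : expQZ (-t) = starRingEnd ℂ (expQZ t) := by
  rw [expQZ, map_neg, AddCircle.toCircle_neg, Circle.coe_inv_eq_conj]
  rfl

theorem expQZ_injective : Function.Injective expQZ := by
  intro s t h
  have h1 := AddCircle.injective_toCircle (T := (1 : ℝ)) one_ne_zero (Subtype.ext h)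
  rw [← sub_eq_zero] at h1 ⊢
  rw [← map_sub] at h1
  induction s using QuotientAddGroup.induction_on with | H a =>
  induction t using QuotientAddGroup.induction_on with | H b =>
  rw [← QuotientAddGroup.mk_sub] at h1 ⊢
  rw [QuotientAddGroup.map_mk, QuotientAddGroup.eq_zero_iff, AddSubgroup.mem_zmultiples_iff] at h1
  obtain ⟨n, hn⟩ := h1
  rw [QuotientAddGroup.eq_zero_iff, AddSubgroup.mem_zmultiples_iff]
  refine ⟨n, ?_⟩
  simp only [zsmul_eq_mul, mul_one, AddMonoidHom.coe_coe, Rat.coe_castHom] at hn ⊢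
  exact_mod_cast hn

/-- The normalized Gauss sum of a non-degenerate quadratic function on a finite abelian
`2`-group is an eighth root of unity. -/
theorem gaussSum_isEighthRoot {G : Type*} [AddCommGroup G] [Fintype G]
    (q : G → AddCircle (1 : ℚ)) (M : ℕ) (hG : ∀ x : G, 2 ^ M • x = 0)
    (hq : ∀ x, 2 ^ M • q x = 0)
    (hB : ∀ x y z, q (x + (y + z)) - q x - q (y + z) =
      (q (x + y) - q x - q y) + (q (x + z) - q x - q z))
    (hnd : ∀ x, (∀ y, q (x + y) - q x - q y = 0) → x = 0)
    (h4 : ∀ (a b c d : ℤ) (x y z w : G),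
      q (a • x - b • y - c • z - d • w) + q (b • x + a • y - d • z + c • w) +
        q (c • x + d • y + a • z - b • w) + q (d • x - c • y + b • z + a • w) =
      (a ^ 2 + b ^ 2 + c ^ 2 + d ^ 2) • (q x + q y + q z + q w)) :
    ∃ a : ZMod 8, (∑ x, expQZ (q x)) / (√(Fintype.card G) : ℝ) = ZMod.stdAddChar a := by
  classical
  set S := ∑ x, expQZ (q x) with hS
  have hq0 : q 0 = 0 := by
    have := hB 0 0 0
    simpa using this
  have habs : S * starRingEnd ℂ S = Fintype.card G := by
    have h1 : S * starRingEnd ℂ S = ∑ y, ∑ x, expQZ (q x - q y) := by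
      rw [hS, map_sum, Finset.mul_sum]
      refine Finset.sum_congr rfl fun y _ => ?_
      rw [Finset.sum_mul]
      exact Finset.sum_congr rfl fun x _ => by rw [sub_eq_add_neg, expQZ_add, expQZ_neg]
    have h2 : ∀ y, ∑ x, expQZ (q x - q y) = ∑ z, expQZ (q z) * expQZ (q (z + y) - q z - q y) := by
      intro y
      rw [← Equiv.sum_comp (Equiv.addRight y)]
      refine Finset.sum_congr rfl fun z _ => ?_
      rw [← expQZ_add]
      congr 1
      simp only [Equiv.coe_addRight]
      abel
    have h3 : ∀ z, ∑ y, expQZ (q (z + y) - q z - q y) = if z = 0 then (Fintype.card G : ℂ) else 0 := by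
      intro z
      let χ : AddChar G ℂ :=
        { toFun := fun y => expQZ (q (z + y) - q z - q y)
          map_zero_eq_one' := by simp [hq0, expQZ_zero]
          map_add_eq_mul' := fun x y => by rw [hB, expQZ_add] }
      split_ifs with h
      · subst h; simp [hq0, expQZ_zero]
      · have : χ ≠ 0 := by
          intro hχ
          apply h
          apply hnd
          intro y
          apply expQZ_injective
          rw [expQZ_zero]
          exact DFunLike.congr_fun hχ y
        exact (AddChar.sum_eq_zero_iff_ne_zero (ψ := χ)).2 this
    rw [h1]
    simp_rw [h2]
    rw [Finset.sum_comm]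
    simp_rw [← Finset.mul_sum, h3]
    simp [hq0, expQZ_zero]
  have hreal : starRingEnd ℂ (S ^ 4) = S ^ 4 := by
    let Q : G × G × G × G → AddCircle (1 : ℚ) := fun u => q u.1 + q u.2.1 + q u.2.2.1 + q u.2.2.2
    have hS4 : S ^ 4 = ∑ u, expQZ (Q u) := by
      simp only [Q, Fintype.sum_prod_type, expQZ_add, ← Finset.mul_sum, ← Finset.sum_mul]
      ring
    obtain ⟨a, b, c, d, habcd⟩ := Nat.sum_four_squares (2 ^ M - 1)
    have hn : (a ^ 2 + b ^ 2 + c ^ 2 + d ^ 2 : ℤ) = 2 ^ M - 1 := by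
      have : 1 ≤ 2 ^ M := Nat.one_le_two_pow
      zify [this] at habcd
      exact habcd
    let φ : ℤ → ℤ → ℤ → ℤ → G × G × G × G → G × G × G × G := fun a b c d u =>
      (a • u.1 - b • u.2.1 - c • u.2.2.1 - d • u.2.2.2,
        b • u.1 + a • u.2.1 - d • u.2.2.1 + c • u.2.2.2,
        c • u.1 + d • u.2.1 + a • u.2.2.1 - b • u.2.2.2,
        d • u.1 - c • u.2.1 + b • u.2.2.1 + a • u.2.2.2)
    have hneg : ∀ x : G, (2 ^ M - 1 : ℤ) • x = -x := by
      intro x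
      have := hG x
      rw [← natCast_zsmul] at this
      push_cast at this
      rw [sub_smul, this, one_smul, zero_sub]
    have hneg' : ∀ x, (2 ^ M - 1 : ℤ) • Q x = -Q x := by
      intro x
      have : (2 ^ M : ℕ) • Q x = 0 := by simp [Q, smul_add, hq]
      rw [← natCast_zsmul] at this
      push_cast at this
      rw [sub_smul, this, one_smul, zero_sub]
    have hφ : ∀ u, φ a (-b) (-c) (-d) (φ a b c d u) = -u := by
      rintro ⟨x, y, z, w⟩
      simp only [φ, Prod.neg_mk, ← hneg, ← hn]
      refine Prod.ext ?_ (Prod.ext ?_ (Prod.ext ?_ ?_)) <;> simp only <;> module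
    have hinj : Function.Injective (φ a b c d) := by
      intro u v h
      have := hφ u
      rw [h, hφ v] at this
      exact (neg_injective this).symm
    have hbij := Finite.injective_iff_bijective.1 hinj
    rw [hS4, map_sum, ← Function.Bijective.sum_comp hbij (fun u => expQZ (Q u))]
    refine Finset.sum_congr rfl fun u _ => ?_
    rw [← expQZ_neg, ← hneg', ← hn]
    congr 1
    exact (h4 a b c d u.1 u.2.1 u.2.2.1 u.2.2.2).symm
  have hcard : (0 : ℝ) < Fintype.card G := by exact_mod_cast Fintype.card_pos
  have hsq : ((√(Fintype.card G) : ℝ) : ℂ) ^ 2 = Fintype.card G := by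
    rw [← Complex.ofReal_pow, Real.sq_sqrt hcard.le]; simp
  have hne : (Fintype.card G : ℂ) ≠ 0 := by exact_mod_cast hcard.ne'
  have h8 : (S / (√(Fintype.card G) : ℝ)) ^ 8 = 1 := by
    have h1 : S ^ 8 = (Fintype.card G : ℂ) ^ 4 := by
      calc S ^ 8 = S ^ 4 * starRingEnd ℂ (S ^ 4) := by rw [hreal]; ring
        _ = (S * starRingEnd ℂ S) ^ 4 := by rw [map_pow]; ring
        _ = _ := by rw [habs]
    rw [div_pow, h1, show ((√(Fintype.card G) : ℝ) : ℂ) ^ 8 = (((√(Fintype.card G) : ℝ) : ℂ) ^ 2) ^ 4 by ring, hsq, div_self (pow_ne_zero _ hne)]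
  obtain ⟨i, -, hi⟩ := (Complex.isPrimitiveRoot_exp 8 (by norm_num)).eq_pow_of_pow_eq_one h8
  refine ⟨((i : ℤ) : ZMod 8), ?_⟩
  rw [ZMod.stdAddChar_coe, ← hi, ← Complex.exp_nat_mul]
  congr 1
  push_cast
  ring

/-- The subgroup `{x ∈ A | n x = 0}`. -/
def torsionPow (A : Type*) [AddCommGroup A] (n : ℕ) : AddSubgroup A :=
  (nsmulAddMonoidHom n : A →+ A).ker

theorem mem_torsionPow {A : Type*} [AddCommGroup A] {n : ℕ} {x : A} :
    x ∈ torsionPow A n ↔ n • x = 0 := Iff.rfl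

/-- A symmetric non-degenerate bilinear form `D × D → ℚ/ℤ` on a finite abelian group `D`.
Here `ℚ/ℤ` is `AddCircle (1 : ℚ)`. -/
structure FiniteBilinearForm (D : Type*) [AddCommGroup D] [Finite D] where
  toHom : D →+ D →+ AddCircle (1 : ℚ)
  symm : ∀ x y, toHom x y = toHom y x
  nondegenerate : ∀ x, (∀ y, toHom x y = 0) → x = 0

namespace FiniteBilinearForm

variable {D : Type*} [AddCommGroup D] [Finite D]

/-- The form `-b`. -/
instance : Neg (FiniteBilinearForm D) where
  neg b :=
    { toHom := -b.toHom
      symm := fun x y => by simp [b.symm x y]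
      nondegenerate := fun x hx => b.nondegenerate x fun y => by simpa using hx y }

/-- `(D, b) ≅ (D', b')`. -/
def Isometric {D' : Type*} [AddCommGroup D'] [Finite D'] (b : FiniteBilinearForm D)
    (b' : FiniteBilinearForm D') : Prop :=
  ∃ f : D ≃+ D', ∀ x y, b.toHom x y = b'.toHom (f x) (f y)

/-- For `G_k = {x ∈ D | 2^k x = 0}`, the subgroup `G_{k-1} + 2 G_{k+1}` of `G_k`. -/
def rhoKernel (D : Type*) [AddCommGroup D] (k : ℕ+) :
    AddSubgroup (torsionPow D (2 ^ (k : ℕ))) :=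
  (torsionPow D (2 ^ ((k : ℕ) - 1)) ⊔
    (torsionPow D (2 ^ ((k : ℕ) + 1))).map (nsmulAddMonoidHom 2)).addSubgroupOf _

/-- `ρ_{2,k}(D) = G_k / (G_{k-1} + 2 G_{k+1})`, where `G_k = {x ∈ D | 2^k x = 0}`. It is an
elementary abelian `2`-group of rank `d_2^k`. -/
abbrev Rho (D : Type*) [AddCommGroup D] (k : ℕ+) : Type _ :=
  torsionPow D (2 ^ (k : ℕ)) ⧸ rhoKernel D k

theorem rho_vanish (b : FiniteBilinearForm D) (k : ℕ+) (x y : torsionPow D (2 ^ (k : ℕ)))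
    (hy : y ∈ rhoKernel D k) : 2 ^ ((k : ℕ) - 1) • b.toHom x y = 0 := by
  obtain ⟨y, hy'⟩ := y
  obtain ⟨x, hx⟩ := x
  rw [rhoKernel, AddSubgroup.mem_addSubgroupOf, AddSubgroup.mem_sup] at hy
  obtain ⟨u, hu, v, ⟨w, -, rfl⟩, rfl⟩ := hy
  rw [mem_torsionPow] at hu hx
  have h1 : 2 ^ ((k : ℕ) - 1) • b.toHom x u = 0 := by rw [← map_nsmul, hu, map_zero]
  have h2 : 2 ^ ((k : ℕ) - 1) • b.toHom x (2 • w) = 0 := by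
    rw [map_nsmul, ← mul_smul, ← pow_succ, Nat.sub_add_cancel k.pos, ← AddMonoidHom.nsmul_apply,
      ← map_nsmul, hx, map_zero, AddMonoidHom.zero_apply]
  simp only [nsmulAddMonoidHom_apply, map_add, smul_add, h1, h2, add_zero]

/-- The form `ρ_{2,k}(b)(x̄, ȳ) = 2^(k-1) b(x, y)` on `ρ_{2,k}(D)`. -/
def rhoForm (b : FiniteBilinearForm D) (k : ℕ+) (u v : Rho D k) : AddCircle (1 : ℚ) :=
  Quotient.liftOn₂' u v (fun x y => 2 ^ ((k : ℕ) - 1) • b.toHom x y) (by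
    intro x y x' y' hx hy
    rw [QuotientAddGroup.leftRel_apply] at hx hy
    have h1 := rho_vanish b k x _ hy
    have h2 := rho_vanish b k y' _ hx
    rw [b.symm] at h2
    simp only [AddSubgroup.coe_add, AddSubgroup.coe_neg, map_add, map_neg,
      AddMonoidHom.add_apply, AddMonoidHom.neg_apply, smul_add, smul_neg] at h1 h2
    rw [neg_add_eq_zero] at h1 h2
    exact h1.trans h2)

/-- `ρ_{2,k}(b)` is of type `E` (or zero): it is alternating. A non-degenerate form on an elementary
abelian `2`-group is an orthogonal sum of copies of the hyperbolic plane `E_2` on `(ℤ/2)²` if and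
only if it is alternating; otherwise it is of type `A`, an orthogonal sum of `d ≥ 1` copies of the
form `xy/2` on `ℤ/2`. -/
def IsTypeE (b : FiniteBilinearForm D) (k : ℕ+) : Prop :=
  ∀ u : Rho D k, b.rhoForm k u u = 0

/-- `D_2 / {x ∈ D_2 | 2^k x = 0}`, with `D_2` the `2`-primary component of `D`. -/
abbrev SigGroup (D : Type*) [AddCommGroup D] (k : ℕ+) : Type _ :=
  AddCommGroup.primaryComponent D 2 ⧸
    torsionPow (AddCommGroup.primaryComponent D 2) (2 ^ (k : ℕ))

/-- The quadratic function `q_k(x̄) = 2^(k-1) b(x, x)` on `D_2 / {x | 2^k x = 0}`, which is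
well-defined when `ρ_{2,k}(b)` is of type `E`. -/
def sigForm (b : FiniteBilinearForm D) (k : ℕ+) (h : b.IsTypeE k) (u : SigGroup D k) :
    AddCircle (1 : ℚ) :=
  Quotient.liftOn' u (fun x => 2 ^ ((k : ℕ) - 1) • b.toHom x x) (by
    intro x y hxy
    rw [QuotientAddGroup.leftRel_apply] at hxy
    obtain ⟨z, rfl⟩ : ∃ z, y = x + z := ⟨-x + y, by abel⟩
    rw [neg_add_cancel_left, mem_torsionPow] at hxy
    have hz : 2 ^ (k : ℕ) • (z : D) = 0 := congrArg Subtype.val hxy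
    have h1 : 2 ^ ((k : ℕ) - 1) • b.toHom z z = 0 :=
      h (QuotientAddGroup.mk (⟨z, hz⟩ : torsionPow D (2 ^ (k : ℕ))))
    have h2 : 2 ^ ((k : ℕ) - 1) • (b.toHom x z + b.toHom x z) = 0 := by
      rw [← two_nsmul, ← mul_smul, ← pow_succ, Nat.sub_add_cancel k.pos, ← map_nsmul, hz, map_zero]
    simp only [AddSubgroup.coe_add, map_add, AddMonoidHom.add_apply, b.symm z x]
    simp only [smul_add, h1, add_zero] at h2 ⊢
    rw [add_assoc, h2, add_zero])

theorem sigForm_mk (b : FiniteBilinearForm D) (k : ℕ+) (h : b.IsTypeE k)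
    (x : AddCommGroup.primaryComponent D 2) :
    b.sigForm k h (QuotientAddGroup.mk x) = 2 ^ ((k : ℕ) - 1) • b.toHom x x := rfl

/-- The normalized Gauss sum `S_k(b)` of `q_k`. -/
noncomputable def sigSum (b : FiniteBilinearForm D) (k : ℕ+) (h : b.IsTypeE k) : ℂ :=
  (∑ᶠ u : SigGroup D k, expQZ (b.sigForm k h u)) / (√(Nat.card (SigGroup D k)) : ℝ)

theorem sigForm_polar (b : FiniteBilinearForm D) (k : ℕ+) (h : b.IsTypeE k)
    (x y : AddCommGroup.primaryComponent D 2) :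
    b.sigForm k h (QuotientAddGroup.mk x + QuotientAddGroup.mk y)
      - b.sigForm k h (QuotientAddGroup.mk x) - b.sigForm k h (QuotientAddGroup.mk y)
      = 2 ^ (k : ℕ) • b.toHom x y := by
  rw [← QuotientAddGroup.mk_add]
  simp only [sigForm_mk, AddSubgroup.coe_add, map_add, AddMonoidHom.add_apply, smul_add,
    b.symm y x]
  have : 2 ^ (k : ℕ) • b.toHom x y =
      2 ^ ((k : ℕ) - 1) • b.toHom x y + 2 ^ ((k : ℕ) - 1) • b.toHom x y := by
    rw [← two_nsmul, ← mul_smul, ← pow_succ', Nat.sub_add_cancel k.pos]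
  rw [this]
  abel

/-- `S_k(b) = exp (2πi a / 8)` for some `a ∈ ℤ/8`. -/
theorem exists_sigSum_eq (b : FiniteBilinearForm D) (k : ℕ+) (h : b.IsTypeE k) :
    ∃ a : ZMod 8, b.sigSum k h = ZMod.stdAddChar a := by
  classical
  let _ : Fintype (SigGroup D k) := Fintype.ofFinite _
  obtain ⟨M, r, hr, hM⟩ : ∃ M r : ℕ, Odd r ∧ Nat.card D = 2 ^ M * r :=
    Nat.exists_eq_two_pow_mul_odd Nat.card_pos.ne'
  have hP : ∀ x : AddCommGroup.primaryComponent D 2, 2 ^ M • x = 0 := by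
    rintro ⟨x, hx⟩
    obtain ⟨n, hn⟩ := hx
    refine Subtype.ext ?_
    change 2 ^ M • x = 0
    have h1 : addOrderOf x ∣ 2 ^ n := addOrderOf_dvd_of_nsmul_eq_zero hn
    have h2 : addOrderOf x ∣ 2 ^ M * r := hM ▸ addOrderOf_dvd_natCard x
    have h3 : Nat.Coprime (addOrderOf x) r :=
      Nat.Coprime.coprime_dvd_left h1 (Nat.Coprime.pow_left _ (Nat.coprime_two_left.2 hr))
    exact addOrderOf_dvd_iff_nsmul_eq_zero.1 (h3.dvd_of_dvd_mul_right h2)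
  have hPr : ∀ x : D, r • x ∈ AddCommGroup.primaryComponent D 2 := fun x =>
    ⟨M, by rw [← mul_smul, ← hM]; exact card_nsmul_eq_zero'⟩
  have hval : ∀ x y : AddCommGroup.primaryComponent D 2, 2 ^ M • b.toHom x y = 0 := by
    intro x y
    have : 2 ^ M • (y : D) = 0 := congrArg Subtype.val (hP y)
    rw [← map_nsmul, this, map_zero]
  unfold sigSum
  rw [finsum_eq_sum_of_fintype, Nat.card_eq_fintype_card]
  refine gaussSum_isEighthRoot (b.sigForm k h) M ?_ ?_ ?_ ?_ ?_
  · intro u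
    induction u using QuotientAddGroup.induction_on with | H x =>
    rw [← QuotientAddGroup.mk_nsmul, hP, QuotientAddGroup.mk_zero]
  · intro u
    induction u using QuotientAddGroup.induction_on with | H x =>
    rw [sigForm_mk, smul_comm, hval, smul_zero]
  · intro u v w
    induction u using QuotientAddGroup.induction_on with | H x =>
    induction v using QuotientAddGroup.induction_on with | H y =>
    induction w using QuotientAddGroup.induction_on with | H z =>
    rw [← QuotientAddGroup.mk_add, sigForm_polar, sigForm_polar, sigForm_polar]
    simp
  · intro u hu
    induction u using QuotientAddGroup.induction_on with | H x =>
    rw [QuotientAddGroup.eq_zero_iff, mem_torsionPow]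
    refine Subtype.ext (b.nondegenerate _ fun y => ?_)
    have h1 := hu (QuotientAddGroup.mk ⟨r • y, hPr y⟩)
    rw [sigForm_polar] at h1
    simp only [map_nsmul] at h1
    have h2 : r • b.toHom ((2 ^ (k : ℕ) • x : AddCommGroup.primaryComponent D 2) : D) y = 0 := by
      simp only [AddSubgroup.coe_nsmul, map_nsmul, AddMonoidHom.nsmul_apply]
      rw [smul_comm]
      exact h1
    have h3 : 2 ^ M • b.toHom ((2 ^ (k : ℕ) • x : AddCommGroup.primaryComponent D 2) : D) y = 0 := by
      rw [← AddMonoidHom.nsmul_apply, ← map_nsmul, ← AddSubgroup.coe_nsmul, hP]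
      simp
    have h4 : Nat.Coprime r (2 ^ M) := (Nat.Coprime.pow_left M (Nat.coprime_two_left.2 hr)).symm
    rw [← addOrderOf_dvd_iff_nsmul_eq_zero] at h2 h3
    exact AddMonoid.addOrderOf_eq_one_iff.1 (Nat.eq_one_of_dvd_coprimes h4 h2 h3)
  · intro a b' c d u v w t
    induction u using QuotientAddGroup.induction_on with | H x =>
    induction v using QuotientAddGroup.induction_on with | H y =>
    induction w using QuotientAddGroup.induction_on with | H z =>
    induction t using QuotientAddGroup.induction_on with | H t =>
    simp only [← QuotientAddGroup.mk_zsmul, ← QuotientAddGroup.mk_add, ← QuotientAddGroup.mk_sub,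
      sigForm_mk]
    simp only [AddSubgroup.coe_add, AddSubgroup.coe_sub, AddSubgroup.coe_zsmul, map_add, map_sub,
      map_zsmul, AddMonoidHom.add_apply, AddMonoidHom.sub_apply, AddMonoidHom.zsmul_apply,
      b.symm y x, b.symm z x, b.symm t x, b.symm z y, b.symm t y, b.symm t z]
    module

open Classical in
/-- The Kawauchi–Kojima signature invariant `σ_k(b) ∈ ℤ/8 ∪ {∞}`: it is `∞` if `ρ_{2,k}(b)` is of
type `A`, and otherwise it is the class `a` with `S_k(b) = exp (2πi a / 8)`. -/
noncomputable def signature (b : FiniteBilinearForm D) (k : ℕ+) : WithTop (ZMod 8) :=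
  if h : b.IsTypeE k then ((b.exists_sigSum_eq k h).choose : ZMod 8) else ⊤

/-- The finite value `a` of `σ_k(b)` is determined by `S_k(b) = exp (2πi a / 8)`. -/
theorem signature_eq_coe_iff (b : FiniteBilinearForm D) (k : ℕ+) (a : ZMod 8) :
    b.signature k = a ↔ ∃ h : b.IsTypeE k, b.sigSum k h = ZMod.stdAddChar a := by
  unfold signature
  split_ifs with h
  · have hc := (b.exists_sigSum_eq k h).choose_spec
    rw [WithTop.coe_inj, exists_prop_of_true h]
    exact ⟨fun h1 => h1 ▸ hc, fun h1 => ZMod.injective_stdAddChar (hc.symm.trans h1)⟩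
  · simp [h]

theorem signature_eq_top_iff (b : FiniteBilinearForm D) (k : ℕ+) :
    b.signature k = ⊤ ↔ ¬ b.IsTypeE k := by
  unfold signature
  split_ifs with h <;> simp [h]

end FiniteBilinearForm

/-! Call a form anti-isometric if it is isometric to its negative. Splitting off nondegenerate
subforms writes any form as an orthogonal sum of cyclic blocks `a x y / p^k` with `p ∤ a` and of
planes over `ℤ/2^k` with even diagonal and odd off-diagonal entry. Such planes are anti-isometric
(`evenPlane_antiIsometric`), so only the list of blocks matters (`exists_hasBlocks`).

Necessity. On the blocks `ℤ/p^k` an anti-isometry induces over `𝔽_p` an identity `Mᵀ Γ M = -Γ` with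
`Γ` diagonal and invertible; determinants make `(-1)^n` a square, so the number `n` of blocks is
even when `p ≡ 3 mod 4` (`HasBlocks.even_blockRank`). Passing from `b` to `-b` conjugates Gauss
sums, so those of an anti-isometric form are real, which leaves only `0` and `4` as finite values of
`σ_k`.

Sufficiency at odd primes. If `p ≡ 1 mod 4`, a square root of `-1` makes each block anti-isometric.
For every odd `p`, two blocks of equal order form an anti-isometric pair, because a conic over `𝔽_p`
has a point and Hensel's lemma lifts it.

Sufficiency at `2`. When no block `ℤ/2^j` occurs, level `j` is alternating and the Gauss sum `S`
satisfies `conj S = i^(-t) S`, where `t` is the sum of the numerators `a` of all blocks `ℤ/2^k` with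
`k > j`. Reality of the nonzero `S` thus means `4 ∣ t` (`HasBlocks.oddityCondition`). Two blocks in
equal or adjacent levels with `4 ∣ a + a'` are anti-isometric. The conditions `4 ∣ t` forbid gaps
below the topmost blocks, so the three highest blocks lie close together. Either two of them already
form such a pair, or adding `2` mod `4` to both numerators in adjacent levels (`exists_double`)
produces one, or three blocks of one level merge into a single block and an even plane
(`HasBlocks.exists_sum`). Induction on the number of blocks finishes the proof. -/

/-! ### The homomorphism `ℤ/N → ℚ/ℤ` -/

/-- The embedding `ℤ/N → ℚ/ℤ`, `m ↦ m / N`. -/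
noncomputable def zmodFrac (N : ℕ) [NeZero N] : ZMod N →+ AddCircle (1 : ℚ) :=
  ZMod.lift N ⟨(QuotientAddGroup.mk' (AddSubgroup.zmultiples (1 : ℚ))).comp
    (zmultiplesHom ℚ (1 / N : ℚ)), by
      have hN : (N : ℚ) ≠ 0 := Nat.cast_ne_zero.2 (NeZero.ne N)
      rw [AddMonoidHom.comp_apply, zmultiplesHom_apply, QuotientAddGroup.mk'_apply,
        QuotientAddGroup.eq_zero_iff, AddSubgroup.mem_zmultiples_iff]
      exact ⟨1, by simp [hN]⟩⟩

theorem zmodFrac_intCast (N : ℕ) [NeZero N] (m : ℤ) :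
    zmodFrac N m = ((m / N : ℚ) : AddCircle (1 : ℚ)) := by
  rw [zmodFrac, ZMod.lift_coe]
  simp [div_eq_mul_inv]

theorem ratCircle_eq_zero_iff (x : ℚ) : (x : AddCircle (1 : ℚ)) = 0 ↔ ∃ n : ℤ, (n : ℚ) = x := by
  rw [AddCircle.coe_eq_zero_iff]
  simp

theorem zmodFrac_eq_zero_iff (N : ℕ) [NeZero N] (x : ZMod N) : zmodFrac N x = 0 ↔ x = 0 := by
  refine ⟨fun h => ?_, fun h => by simp [h]⟩
  obtain ⟨m, rfl⟩ := ZMod.intCast_surjective x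
  have hN : (N : ℚ) ≠ 0 := Nat.cast_ne_zero.2 (NeZero.ne N)
  rw [zmodFrac_intCast, ratCircle_eq_zero_iff] at h
  obtain ⟨n, hn⟩ := h
  rw [eq_div_iff hN] at hn
  rw [ZMod.intCast_zmod_eq_zero_iff_dvd]
  exact ⟨n, by rw [mul_comm]; exact_mod_cast hn.symm⟩

theorem zmodFrac_injective (N : ℕ) [NeZero N] : Function.Injective (zmodFrac N) :=
  (injective_iff_map_eq_zero _).2 fun x => (zmodFrac_eq_zero_iff N x).1

theorem exists_zmodFrac_eq (N : ℕ) [NeZero N] (t : AddCircle (1 : ℚ)) (ht : N • t = 0) :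
    ∃ m : ℤ, zmodFrac N m = t := by
  have hN : (N : ℚ) ≠ 0 := Nat.cast_ne_zero.2 (NeZero.ne N)
  induction t using QuotientAddGroup.induction_on with | H x =>
  obtain ⟨m, hm⟩ := (ratCircle_eq_zero_iff (N • x)).1 ht
  refine ⟨m, ?_⟩
  rw [zmodFrac_intCast, hm]
  simp [hN]

/-- Brings values on `ℤ/N` and `ℤ/(cN)` to a common denominator, as needed for sums of blocks of
different orders. -/
theorem zmodFrac_mul_left (N c : ℕ) [NeZero N] [NeZero c] [NeZero (c * N)] (m : ℤ) :
    zmodFrac (c * N) ((c * m : ℤ) : ZMod (c * N)) = zmodFrac N m := by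
  have hc : (c : ℚ) ≠ 0 := Nat.cast_ne_zero.2 (NeZero.ne c)
  rw [zmodFrac_intCast, zmodFrac_intCast]
  congr 1
  push_cast
  rw [mul_div_mul_left _ _ hc]

theorem nsmul_zmodFrac (N n : ℕ) [NeZero N] (x : ZMod N) :
    n • zmodFrac N x = zmodFrac N (n * x) := by
  rw [← map_nsmul, nsmul_eq_mul]

theorem zsmul_zmodFrac (N : ℕ) (n : ℤ) [NeZero N] (x : ZMod N) :
    n • zmodFrac N x = zmodFrac N (n * x) := by
  rw [← map_zsmul, zsmul_eq_mul]

/-- The homomorphism `ℤ/N → D` with `1 ↦ g`. -/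
def zmodHom {D : Type*} [AddCommGroup D] (N : ℕ) (g : D) (hg : N • g = 0) : ZMod N →+ D :=
  ZMod.lift N ⟨zmultiplesHom D g, by simpa using hg⟩

theorem zmodHom_intCast {D : Type*} [AddCommGroup D] (N : ℕ) (g : D) (hg : N • g = 0) (m : ℤ) :
    zmodHom N g hg m = m • g := by
  rw [zmodHom, ZMod.lift_coe]
  simp

namespace FiniteBilinearForm

/-! ### Isometries, orthogonal sums and orthogonal splittings -/

section

variable {A B C D : Type*} [AddCommGroup A] [Finite A] [AddCommGroup B] [Finite B]
  [AddCommGroup C] [Finite C] [AddCommGroup D] [Finite D]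

theorem neg_toHom (b : FiniteBilinearForm D) (x y : D) : (-b).toHom x y = -b.toHom x y := rfl

theorem Isometric.refl (b : FiniteBilinearForm D) : b.Isometric b :=
  ⟨AddEquiv.refl D, fun _ _ => rfl⟩

theorem Isometric.symm {a : FiniteBilinearForm A} {b : FiniteBilinearForm B}
    (h : a.Isometric b) : b.Isometric a := by
  obtain ⟨f, hf⟩ := h
  exact ⟨f.symm, fun x y => by simp [hf]⟩

theorem Isometric.trans {a : FiniteBilinearForm A} {b : FiniteBilinearForm B}
    {c : FiniteBilinearForm C} (h : a.Isometric b) (h' : b.Isometric c) : a.Isometric c := by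
  obtain ⟨f, hf⟩ := h
  obtain ⟨g, hg⟩ := h'
  exact ⟨f.trans g, fun x y => by rw [hf, hg]; rfl⟩

theorem Isometric.neg {a : FiniteBilinearForm A} {b : FiniteBilinearForm B}
    (h : a.Isometric b) : (-a).Isometric (-b) := by
  obtain ⟨f, hf⟩ := h
  exact ⟨f, fun x y => by rw [neg_toHom, neg_toHom, hf]⟩

theorem Isometric.antiIsometric {a : FiniteBilinearForm A} {b : FiniteBilinearForm B}
    (h : a.Isometric b) (hb : b.Isometric (-b)) : a.Isometric (-a) :=
  (h.trans hb).trans h.symm.neg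

theorem injective_of_isometry (a : FiniteBilinearForm A) (b : FiniteBilinearForm B)
    (f : A →+ B) (hf : ∀ x y, a.toHom x y = b.toHom (f x) (f y)) : Function.Injective f := by
  rw [injective_iff_map_eq_zero]
  intro x hx
  refine a.nondegenerate x fun y => ?_
  rw [hf, hx, map_zero, AddMonoidHom.zero_apply]

/-- Explicit isometries can thus be given by the images of generators: a form-preserving map is
injective by non-degeneracy, and counting does the rest. -/
theorem isometric_of_hom (a : FiniteBilinearForm A) (b : FiniteBilinearForm B)
    (f : A →+ B) (hf : ∀ x y, a.toHom x y = b.toHom (f x) (f y))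
    (hc : Nat.card A = Nat.card B) : a.Isometric b :=
  ⟨AddEquiv.ofBijective f ((Nat.bijective_iff_injective_and_card f).2
    ⟨injective_of_isometry a b f hf, hc⟩), hf⟩

/-- The orthogonal sum of two forms. -/
def prod (a : FiniteBilinearForm A) (b : FiniteBilinearForm B) :
    FiniteBilinearForm (A × B) where
  toHom := (a.toHom.compl₂ (AddMonoidHom.fst A B)).comp (AddMonoidHom.fst A B) +
    (b.toHom.compl₂ (AddMonoidHom.snd A B)).comp (AddMonoidHom.snd A B)
  symm x y := by
    change a.toHom x.1 y.1 + b.toHom x.2 y.2 = a.toHom y.1 x.1 + b.toHom y.2 x.2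
    rw [a.symm, b.symm]
  nondegenerate x h := by
    refine Prod.ext (a.nondegenerate _ fun y => ?_) (b.nondegenerate _ fun y => ?_)
    · have : a.toHom x.1 y + b.toHom x.2 0 = 0 := h (y, 0)
      simpa using this
    · have : a.toHom x.1 0 + b.toHom x.2 y = 0 := h (0, y)
      simpa using this

theorem prod_toHom (a : FiniteBilinearForm A) (b : FiniteBilinearForm B) (x y : A × B) :
    (a.prod b).toHom x y = a.toHom x.1 y.1 + b.toHom x.2 y.2 := rfl

theorem Isometric.prod {A' B' : Type*} [AddCommGroup A'] [Finite A'] [AddCommGroup B'] [Finite B']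
    {a : FiniteBilinearForm A} {b : FiniteBilinearForm B} {a' : FiniteBilinearForm A'}
    {b' : FiniteBilinearForm B'} (h : a.Isometric a') (h' : b.Isometric b') :
    (a.prod b).Isometric (a'.prod b') := by
  obtain ⟨f, hf⟩ := h
  obtain ⟨g, hg⟩ := h'
  exact ⟨f.prodCongr g, fun x y => by simp only [prod_toHom, hf, hg]; rfl⟩

theorem prod_comm (a : FiniteBilinearForm A) (b : FiniteBilinearForm B) :
    (a.prod b).Isometric (b.prod a) :=
  ⟨AddEquiv.prodComm, fun x y => by simp [prod_toHom, add_comm]⟩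

theorem prod_assoc (a : FiniteBilinearForm A) (b : FiniteBilinearForm B)
    (c : FiniteBilinearForm C) : ((a.prod b).prod c).Isometric (a.prod (b.prod c)) :=
  ⟨AddEquiv.prodAssoc, fun x y => by simp [prod_toHom, add_assoc, AddEquiv.prodAssoc]⟩

theorem prod_left_comm (a : FiniteBilinearForm A) (b : FiniteBilinearForm B)
    (c : FiniteBilinearForm C) : (a.prod (b.prod c)).Isometric (b.prod (a.prod c)) :=
  ((prod_assoc a b c).symm.trans ((prod_comm a b).prod (Isometric.refl c))).trans
    (prod_assoc b a c)

theorem antiIsometric_prod {a : FiniteBilinearForm A} {b : FiniteBilinearForm B}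
    (ha : a.Isometric (-a)) (hb : b.Isometric (-b)) : (a.prod b).Isometric (-(a.prod b)) :=
  (ha.prod hb).trans ⟨AddEquiv.refl _, fun x y => by
    simp only [prod_toHom, neg_toHom, AddEquiv.refl_apply, neg_add]⟩

/-- Two isometric embeddings with orthogonal images whose orders multiply to that of the target. -/
theorem isometric_prod_of_orthogonal (a : FiniteBilinearForm A) (b : FiniteBilinearForm B)
    (d : FiniteBilinearForm D) (f : A →+ D) (g : B →+ D)
    (hf : ∀ x y, a.toHom x y = d.toHom (f x) (f y))
    (hg : ∀ x y, b.toHom x y = d.toHom (g x) (g y))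
    (hfg : ∀ x y, d.toHom (f x) (g y) = 0)
    (hc : Nat.card A * Nat.card B = Nat.card D) : (a.prod b).Isometric d := by
  refine isometric_of_hom _ _ (f.coprod g) (fun x y => ?_) (by rw [Nat.card_prod, hc])
  simp only [prod_toHom, AddMonoidHom.coprod_apply, map_add, AddMonoidHom.add_apply, hf, hg, hfg,
    d.symm (g x.2) (f y.1)]
  abel

/-- Every homomorphism `A → ℚ/ℤ` is `a(u, ·)` for some `u`. -/
theorem exists_toHom_eq (a : FiniteBilinearForm A) (φ : A →+ AddCircle (1 : ℚ)) :
    ∃ u, a.toHom u = φ := by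
  classical
  let _ : Fintype A := Fintype.ofFinite A
  -- Composition with `expQZ` embeds `Hom(A, ℚ/ℤ)` into the complex characters, of which there are
  -- `|A|`. Since `u ↦ a(u, ·)` is injective, counting makes the composite from `A` bijective.
  let Φ : (A →+ AddCircle (1 : ℚ)) → AddChar A ℂ := fun ψ =>
    { toFun := fun x => expQZ (ψ x)
      map_zero_eq_one' := by simp [expQZ_zero]
      map_add_eq_mul' := fun x y => by simp [expQZ_add] }
  have hΦ : Function.Injective Φ := fun ψ χ h =>
    AddMonoidHom.ext fun x => expQZ_injective (DFunLike.congr_fun h x)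
  have hinj : Function.Injective fun u => Φ (a.toHom u) := by
    intro u v h
    have h' := hΦ h
    rw [← sub_eq_zero]
    refine a.nondegenerate _ fun y => ?_
    rw [map_sub, h', sub_self, AddMonoidHom.zero_apply]
  have hbij : Function.Bijective fun u => Φ (a.toHom u) :=
    (Fintype.bijective_iff_injective_and_card _).2 ⟨hinj, AddChar.card_eq.symm⟩
  obtain ⟨u, hu⟩ := hbij.2 (Φ φ)
  exact ⟨u, hΦ hu⟩

end

/-- A non-degenerate subform splits off as an orthogonal summand. -/
theorem exists_isometric_prod {A : Type*} [AddCommGroup A] [Finite A] {D : Type*}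
    [AddCommGroup D] [Finite D] (a : FiniteBilinearForm A) (d : FiniteBilinearForm D)
    (f : A →+ D) (hf : ∀ x y, a.toHom x y = d.toHom (f x) (f y)) :
    ∃ (K : AddSubgroup D) (b : FiniteBilinearForm K), d.Isometric (a.prod b) := by
  have hproj : ∀ z, ∃ u, ∀ x, d.toHom z (f x) = a.toHom u x := fun z => by
    obtain ⟨u, hu⟩ := a.exists_toHom_eq ((d.toHom z).comp f)
    exact ⟨u, fun x => by rw [hu]; rfl⟩
  -- The orthogonal complement of the image of `f`. Non-degeneracy of `a` supplies orthogonal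
  -- projections onto that image.
  let K : AddSubgroup D :=
    { carrier := {z | ∀ x, d.toHom z (f x) = 0}
      zero_mem' := fun x => by simp
      add_mem' := fun {y z} hy hz x => by
        have hy : d.toHom y (f x) = 0 := hy x
        have hz : d.toHom z (f x) = 0 := hz x
        simp [hy, hz]
      neg_mem' := fun {y} hy x => by
        have hy : d.toHom y (f x) = 0 := hy x
        simp [hy] }
  have hK : ∀ z u, (∀ x, d.toHom z (f x) = a.toHom u x) → z - f u ∈ K := by
    intro z u hu x
    rw [map_sub, AddMonoidHom.sub_apply, hu, ← hf, sub_self]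
  let b : FiniteBilinearForm K :=
    { toHom := (d.toHom.comp K.subtype).compl₂ K.subtype
      symm := fun x y => d.symm _ _
      -- An element of `K` orthogonal to `K` is also orthogonal to the image of `f`, hence to all of
      -- `D`.
      nondegenerate := fun x hx => Subtype.ext (d.nondegenerate _ fun z => by
        obtain ⟨u, hu⟩ := hproj z
        have h1 : d.toHom x (z - f u) = 0 := hx ⟨_, hK z u hu⟩
        have h2 : d.toHom x (f u) = 0 := x.2 u
        rwa [map_sub, h2, sub_zero] at h1) }
  refine ⟨K, b, Isometric.symm ?_⟩
  have hφ : ∀ x y, (a.prod b).toHom x y =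
      d.toHom ((f.coprod K.subtype) x) ((f.coprod K.subtype) y) := by
    intro x y
    have h1 : d.toHom (f x.1) y.2 = 0 := by rw [d.symm]; exact y.2.2 _
    have h2 : d.toHom x.2 (f y.1) = 0 := x.2.2 _
    have h3 : b.toHom x.2 y.2 = d.toHom x.2 y.2 := rfl
    simp only [prod_toHom, AddMonoidHom.coprod_apply, map_add, AddMonoidHom.add_apply, hf,
      AddSubgroup.coe_subtype, h1, h2, h3]
    abel
  refine ⟨AddEquiv.ofBijective (f.coprod K.subtype) ⟨injective_of_isometry _ d _ hφ, fun z => ?_⟩,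
    hφ⟩
  obtain ⟨u, hu⟩ := hproj z
  exact ⟨(u, ⟨_, hK z u hu⟩), by simp⟩

/-! ### Cyclic forms and even forms of rank two -/

/-- The form `a x y / N` on `ℤ/N`. -/
noncomputable def cyclic (N : ℕ) [NeZero N] (a : ℤ) (ha : IsCoprime a N) :
    FiniteBilinearForm (ZMod N) where
  toHom := (AddMonoidHom.mul.comp (AddMonoidHom.mulLeft (a : ZMod N))).compr₂ (zmodFrac N)
  symm x y := by
    change zmodFrac N (a * x * y) = zmodFrac N (a * y * x)
    rw [mul_right_comm]
  nondegenerate x h := by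
    have h1 : zmodFrac N (a * x * 1) = 0 := h 1
    rw [zmodFrac_eq_zero_iff, mul_one] at h1
    obtain ⟨u, v, huv⟩ := ha
    have h2 : ((u * a + v * N : ℤ) : ZMod N) = 1 := by rw [huv]; simp
    push_cast at h2
    rw [ZMod.natCast_self, mul_zero, add_zero] at h2
    rw [← one_mul x, ← h2, mul_assoc, h1, mul_zero]

theorem cyclic_toHom (N : ℕ) [NeZero N] (a : ℤ) (ha : IsCoprime a N) (x y : ZMod N) :
    (cyclic N a ha).toHom x y = zmodFrac N (a * x * y) := rfl

/-- The form on `(ℤ/N)²` with matrix `N⁻¹ [[2α, β], [β, 2γ]]`. -/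
noncomputable def evenPlane (N : ℕ) [NeZero N] (α β γ : ℤ)
    (h : IsCoprime (4 * (α * γ) - β ^ 2) (N : ℤ)) : FiniteBilinearForm (ZMod N × ZMod N) where
  toHom := AddMonoidHom.mk' (fun x => AddMonoidHom.mk'
      (fun y => zmodFrac N (2 * α * x.1 * y.1 + β * (x.1 * y.2 + x.2 * y.1) + 2 * γ * x.2 * y.2))
      fun y z => by rw [← map_add]; congr 1; simp only [Prod.fst_add, Prod.snd_add]; ring)
    fun x z => AddMonoidHom.ext fun y => by
      simp only [AddMonoidHom.add_apply, AddMonoidHom.mk'_apply]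
      rw [← map_add]; congr 1; simp only [Prod.fst_add, Prod.snd_add]; ring
  symm x y := by
    simp only [AddMonoidHom.mk'_apply]
    congr 1
    ring
  nondegenerate x hx := by
    have h1 := hx (1, 0)
    have h2 := hx (0, 1)
    simp only [AddMonoidHom.mk'_apply, zmodFrac_eq_zero_iff] at h1 h2
    -- The determinant `4αγ - β²` is a unit mod `N` with inverse `u`; what follows is Cramer's rule.
    obtain ⟨u, v, huv⟩ := h
    have h3 : ((u * (4 * (α * γ) - β ^ 2) + v * N : ℤ) : ZMod N) = 1 := by rw [huv]; simp
    push_cast at h3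
    rw [ZMod.natCast_self, mul_zero, add_zero] at h3
    refine Prod.ext ?_ ?_
    · change x.1 = 0
      linear_combination (-x.1) * h3 + 2 * γ * u * h1 - β * u * h2
    · change x.2 = 0
      linear_combination (-x.2) * h3 + 2 * α * u * h2 - β * u * h1

theorem evenPlane_toHom (N : ℕ) [NeZero N] (α β γ : ℤ)
    (h : IsCoprime (4 * (α * γ) - β ^ 2) (N : ℤ)) (x y : ZMod N × ZMod N) :
    (evenPlane N α β γ h).toHom x y = zmodFrac N
      (2 * α * x.1 * y.1 + β * (x.1 * y.2 + x.2 * y.1) + 2 * γ * x.2 * y.2) := rfl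

section

variable {D : Type*} [AddCommGroup D] [Finite D]

theorem cyclic_toHom_zmodHom (N : ℕ) [NeZero N] (a : ℤ) (ha : IsCoprime a N)
    (d : FiniteBilinearForm D) (g : D) (hg : N • g = 0) (h : d.toHom g g = zmodFrac N a)
    (x y : ZMod N) : (cyclic N a ha).toHom x y =
      d.toHom (zmodHom N g hg x) (zmodHom N g hg y) := by
  obtain ⟨x, rfl⟩ := ZMod.intCast_surjective x
  obtain ⟨y, rfl⟩ := ZMod.intCast_surjective y
  simp only [cyclic_toHom, zmodHom_intCast, map_zsmul, AddMonoidHom.zsmul_apply, h,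
    zsmul_zmodFrac]
  congr 1
  ring

theorem evenPlane_toHom_zmodHom (N : ℕ) [NeZero N] (α β γ : ℤ)
    (hc : IsCoprime (4 * (α * γ) - β ^ 2) (N : ℤ))
    (d : FiniteBilinearForm D) (g g' : D) (hg : N • g = 0) (hg' : N • g' = 0)
    (h : d.toHom g g = zmodFrac N (2 * α : ℤ)) (h' : d.toHom g g' = zmodFrac N β)
    (h'' : d.toHom g' g' = zmodFrac N (2 * γ : ℤ))
    (x y : ZMod N × ZMod N) : (evenPlane N α β γ hc).toHom x y =
      d.toHom ((zmodHom N g hg).coprod (zmodHom N g' hg') x)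
        ((zmodHom N g hg).coprod (zmodHom N g' hg') y) := by
  obtain ⟨x, x'⟩ := x
  obtain ⟨y, y'⟩ := y
  obtain ⟨x, rfl⟩ := ZMod.intCast_surjective x
  obtain ⟨y, rfl⟩ := ZMod.intCast_surjective y
  obtain ⟨x', rfl⟩ := ZMod.intCast_surjective x'
  obtain ⟨y', rfl⟩ := ZMod.intCast_surjective y'
  simp only [evenPlane_toHom, AddMonoidHom.coprod_apply, zmodHom_intCast, map_zsmul, map_add,
    AddMonoidHom.zsmul_apply, AddMonoidHom.add_apply, h, h', h'', d.symm g' g,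
    smul_add, zsmul_zmodFrac]
  simp only [← map_add]
  congr 1
  push_cast
  ring

theorem toHom_zmodHom_zmodHom_eq_zero (d : FiniteBilinearForm D) (N M : ℕ) (g g' : D)
    (hg : N • g = 0) (hg' : M • g' = 0) (h : d.toHom g g' = 0) (x : ZMod N) (y : ZMod M) :
    d.toHom (zmodHom N g hg x) (zmodHom M g' hg' y) = 0 := by
  obtain ⟨x, rfl⟩ := ZMod.intCast_surjective x
  obtain ⟨y, rfl⟩ := ZMod.intCast_surjective y
  simp [zmodHom_intCast, h]

/-- An orthogonal basis of `d` with two elements. -/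
theorem cyclic_prod_cyclic_isometric (N M : ℕ) [NeZero N] [NeZero M] (a a' : ℤ)
    (ha : IsCoprime a N) (ha' : IsCoprime a' M) (d : FiniteBilinearForm D) (g g' : D)
    (hg : N • g = 0) (hg' : M • g' = 0) (h : d.toHom g g = zmodFrac N a)
    (h' : d.toHom g' g' = zmodFrac M a') (h0 : d.toHom g g' = 0)
    (hc : N * M = Nat.card D) :
    ((cyclic N a ha).prod (cyclic M a' ha')).Isometric d :=
  isometric_prod_of_orthogonal _ _ _ (zmodHom N g hg) (zmodHom M g' hg')
    (cyclic_toHom_zmodHom N a ha d g hg h) (cyclic_toHom_zmodHom M a' ha' d g' hg' h')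
    (toHom_zmodHom_zmodHom_eq_zero d N M g g' hg hg' h0) (by simpa [Nat.card_zmod] using hc)

end

end FiniteBilinearForm

/-! ### Congruences modulo prime powers -/

/-- Hensel's lemma for a quadratic polynomial over `ℤ`. -/
theorem exists_quadratic_root_mod_prime_pow (p : ℕ) (hp : p.Prime) (A B C s₀ : ℤ)
    (h : (p : ℤ) ∣ A * s₀ ^ 2 + B * s₀ + C) (h' : ¬ (p : ℤ) ∣ 2 * A * s₀ + B) (k : ℕ) :
    ∃ s, (p : ℤ) ^ k ∣ A * s ^ 2 + B * s + C := by
  suffices H : ∀ k, ∃ s, (p : ℤ) ^ (k + 1) ∣ A * s ^ 2 + B * s + C ∧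
      ¬ (p : ℤ) ∣ 2 * A * s + B by
    obtain ⟨s, hs, -⟩ := H k
    exact ⟨s, (pow_dvd_pow _ k.le_succ).trans hs⟩
  intro k
  induction k with
  | zero => exact ⟨s₀, by simpa using h, h'⟩
  | succ k ih =>
    obtain ⟨s, ⟨m, hm⟩, hs⟩ := ih
    have hcop : IsCoprime (2 * A * s + B) (p : ℤ) :=
      ((Nat.prime_iff_prime_int.1 hp).coprime_iff_not_dvd.2 hs).symm
    obtain ⟨u, v, huv⟩ := hcop
    -- Newton's step: `u` inverts the derivative `2As + B` mod `p`, and `m` is the current value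
    -- divided by `p^(k+1)`.
    refine ⟨s + p ^ (k + 1) * (-(m * u)), ?_, ?_⟩
    · refine ⟨m * v + A * p ^ k * (m * u) ^ 2, ?_⟩
      linear_combination hm - p ^ (k + 1) * m * huv
    · intro hd
      apply hs
      have h1 : (p : ℤ) ∣ 2 * A * (p ^ (k + 1) * (-(m * u))) :=
        ((dvd_pow_self (p : ℤ) k.succ_ne_zero).mul_right _).mul_left _
      rw [show 2 * A * s + B = 2 * A * (s + p ^ (k + 1) * (-(m * u))) + B -
        2 * A * (p ^ (k + 1) * (-(m * u))) by ring]
      exact dvd_sub hd h1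

/-- Squares of odd numbers fill the class of `1` mod `8`. With `x = 2s + 1` and `a - m = 8c`, the
expression is `4(a s² + a s + 2c)`; the bracket has the root `0` mod `2` and odd derivative `a`
there, so Hensel's lemma applies. -/
theorem exists_mul_sq_mod_two_pow (a m : ℤ) (ha : ¬ (2 : ℤ) ∣ a) (h : (8 : ℤ) ∣ a - m) (k : ℕ) :
    ∃ x, (2 : ℤ) ^ k ∣ a * x ^ 2 - m := by
  obtain ⟨c, hc⟩ := h
  obtain ⟨s, r, hr⟩ := exists_quadratic_root_mod_prime_pow 2 Nat.prime_two a a (2 * c) 0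
    ⟨c, by push_cast; ring⟩ (by simpa using ha) k
  push_cast at hr
  exact ⟨2 * s + 1, 4 * r, by linear_combination 4 * hr + hc⟩

theorem exists_sq_add_one_mod_prime_pow (p : ℕ) [Fact p.Prime] (hp : p % 4 = 1) (k : ℕ) :
    ∃ s : ℤ, (p : ℤ) ^ k ∣ s ^ 2 + 1 := by
  have hp' : p.Prime := Fact.out
  obtain ⟨r, hr⟩ := ZMod.exists_sq_eq_neg_one_iff.2 (show p % 4 ≠ 3 by omega)
  obtain ⟨r, rfl⟩ := ZMod.intCast_surjective r
  have h1 : (p : ℤ) ∣ r ^ 2 + 1 := by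
    rw [← ZMod.intCast_zmod_eq_zero_iff_dvd]
    push_cast
    rw [pow_two, ← hr]
    ring
  have h2 : ¬ (p : ℤ) ∣ 2 * r := by
    intro h
    rcases (Nat.prime_iff_prime_int.1 hp').dvd_or_dvd h with h | h
    · have := Nat.le_of_dvd two_pos (by exact_mod_cast h : p ∣ 2)
      have := hp'.two_le
      omega
    · have h3 : (p : ℤ) ∣ 1 := by
        have := dvd_sub h1 (dvd_pow h two_ne_zero)
        simpa using this
      exact (Nat.prime_iff_prime_int.1 hp').not_dvd_one h3
  obtain ⟨s, hs⟩ := exists_quadratic_root_mod_prime_pow p hp' 1 0 1 r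
    (by convert h1 using 1; ring) (by convert h2 using 2; ring) k
  exact ⟨s, by convert hs using 1; ring⟩

/-- A conic over `𝔽_p` has a point. As `a'` is a unit, `x` and `y` cannot both vanish mod `p`, and
Hensel's lemma lifts in a variable that does not vanish. -/
theorem exists_binary_form_mod_prime_pow (p : ℕ) [Fact p.Prime] (hp : p ≠ 2) (a a' : ℤ)
    (ha : ¬ (p : ℤ) ∣ a) (ha' : ¬ (p : ℤ) ∣ a') (k : ℕ) :
    ∃ x y : ℤ, (p : ℤ) ^ k ∣ a' * y ^ 2 + a * x ^ 2 + a' := by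
  have hp' : p.Prime := Fact.out
  have hpi := Nat.prime_iff_prime_int.1 hp'
  have h2 : ¬ (p : ℤ) ∣ 2 := fun h => hp <| (Nat.prime_dvd_prime_iff_eq hp' Nat.prime_two).1
    (by exact_mod_cast h)
  have hz : ∀ m : ℤ, ¬ (p : ℤ) ∣ m → (m : ZMod p) ≠ 0 := fun m hm h =>
    hm ((ZMod.intCast_zmod_eq_zero_iff_dvd m p).1 h)
  have hd : ∀ (c e : ZMod p), c ≠ 0 →
      (Polynomial.C c * Polynomial.X ^ 2 + Polynomial.C 0 * Polynomial.X + Polynomial.C e).degree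
        = 2 := fun c e hc => Polynomial.degree_quadratic hc
  obtain ⟨y, x, hxy⟩ := FiniteField.exists_root_sum_quadratic (hd a' a' (hz _ ha'))
    (hd a 0 (hz _ ha)) (by
      rw [ZMod.card]
      exact hp'.eq_two_or_odd.resolve_left hp)
  obtain ⟨x, rfl⟩ := ZMod.intCast_surjective x
  obtain ⟨y, rfl⟩ := ZMod.intCast_surjective y
  have h1 : (p : ℤ) ∣ a' * y ^ 2 + a * x ^ 2 + a' := by
    rw [← ZMod.intCast_zmod_eq_zero_iff_dvd]
    push_cast
    simp only [Polynomial.eval_add, Polynomial.eval_mul, Polynomial.eval_C, Polynomial.eval_pow,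
      Polynomial.eval_X] at hxy
    linear_combination hxy
  by_cases hx : (p : ℤ) ∣ x
  · have hy : ¬ (p : ℤ) ∣ y := fun hy => ha' <| by
      have h3 : (p : ℤ) ∣ a' * y ^ 2 + a * x ^ 2 :=
        dvd_add ((dvd_pow hy two_ne_zero).mul_left _) ((dvd_pow hx two_ne_zero).mul_left _)
      exact (dvd_add_right h3).1 h1
    obtain ⟨s, hs⟩ := exists_quadratic_root_mod_prime_pow p hp' a' 0 (a * x ^ 2 + a') y
      (by convert h1 using 1; ring) (fun h => by
        rw [add_zero] at h
        rcases hpi.dvd_or_dvd h with h | h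
        · exact (hpi.dvd_or_dvd h).elim h2 ha'
        · exact hy h) k
    exact ⟨x, s, by convert hs using 1; ring⟩
  · obtain ⟨s, hs⟩ := exists_quadratic_root_mod_prime_pow p hp' a 0 (a' * y ^ 2 + a') x
      (by convert h1 using 1; ring) (fun h => by
        rw [add_zero] at h
        rcases hpi.dvd_or_dvd h with h | h
        · exact (hpi.dvd_or_dvd h).elim h2 ha
        · exact hx h) k
    exact ⟨s, y, by convert hs using 1; ring⟩

theorem isCoprime_two_pow {a : ℤ} (ha : ¬ (2 : ℤ) ∣ a) (k : ℕ) :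
    IsCoprime a ((2 ^ k : ℕ) : ℤ) := by
  push_cast
  exact ((Int.prime_two.coprime_iff_not_dvd.2 ha).symm).pow_right

theorem zmodFrac_intCast_eq_iff (N : ℕ) [NeZero N] (m n : ℤ) :
    zmodFrac N m = zmodFrac N n ↔ (N : ℤ) ∣ m - n := by
  rw [(zmodFrac_injective N).eq_iff, ← sub_eq_zero, ← Int.cast_sub,
    ZMod.intCast_zmod_eq_zero_iff_dvd]

namespace FiniteBilinearForm

/-! ### Isometries between small forms -/

theorem cyclic_toHom_intCast (N : ℕ) [NeZero N] (a : ℤ) (ha : IsCoprime a N) (x y : ℤ) :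
    (cyclic N a ha).toHom x y = zmodFrac N ((a * x * y : ℤ) : ZMod N) := by
  rw [cyclic_toHom]; push_cast; rfl

theorem cyclic_congr (N : ℕ) [NeZero N] (a a' : ℤ) (ha : IsCoprime a N) (ha' : IsCoprime a' N)
    (h : (N : ℤ) ∣ a - a') : (cyclic N a ha).Isometric (cyclic N a' ha') :=
  ⟨AddEquiv.refl _, fun x y => by
    have : (a : ZMod N) = a' := by
      rw [← sub_eq_zero, ← Int.cast_sub, ZMod.intCast_zmod_eq_zero_iff_dvd]; exact h
    simp only [cyclic_toHom, this, AddEquiv.refl_apply]⟩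

theorem cyclic_antiIsometric (N : ℕ) [NeZero N] (a : ℤ) (ha : IsCoprime a N) (s : ℤ)
    (hs : (N : ℤ) ∣ a * s ^ 2 + a) : (cyclic N a ha).Isometric (-cyclic N a ha) := by
  refine isometric_of_hom _ _ (zmodHom N (s : ZMod N) (by simp))
    (cyclic_toHom_zmodHom N a ha _ _ _ ?_) rfl
  rw [neg_toHom, cyclic_toHom_intCast, ← map_neg, ← Int.cast_neg, zmodFrac_intCast_eq_iff]
  obtain ⟨c, hc⟩ := hs
  exact ⟨-c, by linear_combination -hc⟩

/-- The hypothesis says that `(x, y)` has norm `-a'/M`. It plays the role of the second generator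
for the negated form, and a vector orthogonal to it plays that of the first. -/
theorem cyclic_prod_antiIsometric (N M c : ℕ) [NeZero N] [NeZero M] (hM : M = c * N) (a a' : ℤ)
    (ha : IsCoprime a N) (ha' : IsCoprime a' M) (x y : ℤ)
    (h : (M : ℤ) ∣ a' * y ^ 2 + c * a * x ^ 2 + a') :
    ((cyclic N a ha).prod (cyclic M a' ha')).Isometric (-(cyclic N a ha).prod (cyclic M a' ha')) := by
  subst hM
  have : NeZero c := ⟨fun h => NeZero.ne (c * N) (by simp [h])⟩
  have hcop := ha'
  obtain ⟨e, v, hev⟩ := hcop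
  obtain ⟨r, hr⟩ := h
  push_cast at hr hev
  refine cyclic_prod_cyclic_isometric N (c * N) a a' ha ha' _
    -- With `e` the inverse of `a'` mod `cN`, this vector is orthogonal to `(x, y)` and killed by
    -- `N`. Its norm is `ca(y² + c a x² e)/(cN)`, and `y² + c a x² e ≡ e(a' y² + c a x²) ≡ -1`.
    ((y : ZMod N), ((-(c * a * x * e) : ℤ) : ZMod (c * N)))
    ((x : ZMod N), (y : ZMod (c * N))) ?_ ?_ ?_ ?_ ?_ ?_
  · refine Prod.ext (by simp) ?_
    change N • ((-(c * a * x * e) : ℤ) : ZMod (c * N)) = 0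
    rw [nsmul_eq_mul, ← Int.cast_natCast (R := ZMod (c * N)) N, ← Int.cast_mul,
      ZMod.intCast_zmod_eq_zero_iff_dvd]
    exact ⟨-(a * x * e), by push_cast; ring⟩
  · refine Prod.ext ?_ (by simp)
    change (c * N) • (x : ZMod N) = 0
    simp
  · simp only [neg_toHom, prod_toHom, cyclic_toHom_intCast]
    rw [← zmodFrac_mul_left N c, ← zmodFrac_mul_left N c, ← map_add, ← map_neg, ← Int.cast_add,
      ← Int.cast_neg, zmodFrac_intCast_eq_iff]
    refine ⟨-(c * a) * (e * r + v * (y ^ 2 + 1)) + v * c ^ 2 * a ^ 2 * x ^ 2 * e, ?_⟩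
    push_cast
    linear_combination (-c * a * e) * hr + (c * a * y ^ 2 + c * a - c ^ 2 * a ^ 2 * x ^ 2 * e) * hev
  · simp only [neg_toHom, prod_toHom, cyclic_toHom_intCast]
    rw [← zmodFrac_mul_left N c, ← map_add, ← map_neg, ← Int.cast_add,
      ← Int.cast_neg, zmodFrac_intCast_eq_iff]
    exact ⟨-r, by push_cast; linear_combination -hr⟩
  · simp only [neg_toHom, prod_toHom, cyclic_toHom_intCast]
    rw [neg_eq_zero, ← zmodFrac_mul_left N c, ← map_add, ← Int.cast_add, zmodFrac_eq_zero_iff,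
      ZMod.intCast_zmod_eq_zero_iff_dvd]
    exact ⟨c * a * x * y * v, by push_cast; linear_combination (-c * a * x * y) * hev⟩
  · simp

theorem cyclic_two_prod_antiIsometric_of_eq (k : ℕ) (a a' : ℤ) (ha : ¬ (2 : ℤ) ∣ a)
    (h : (4 : ℤ) ∣ a + a') (hc : IsCoprime a (2 ^ k : ℕ)) (hc' : IsCoprime a' (2 ^ k : ℕ)) :
    ((cyclic (2 ^ k) a hc).prod (cyclic (2 ^ k) a' hc')).Isometric
      (-(cyclic (2 ^ k) a hc).prod (cyclic (2 ^ k) a' hc')) := by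
  -- `a x² ≡ -a'(1 + y²)` has to be solved, and only the class mod `8` matters. The factor `1 + y²`
  -- is `1` or `5`, which covers both classes of `a + a'` mod `8` because `a'` is odd.
  obtain ⟨y, hy⟩ : ∃ y : ℤ, (8 : ℤ) ∣ a - (-a' * (1 + y ^ 2)) := by
    by_cases h8 : (8 : ℤ) ∣ a + a'
    · exact ⟨0, by simpa using h8⟩
    · exact ⟨2, by omega⟩
  obtain ⟨x, hx⟩ := exists_mul_sq_mod_two_pow a _ ha hy k
  refine cyclic_prod_antiIsometric _ _ 1 (one_mul _).symm a a' hc hc' x y ?_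
  convert hx using 1
  · push_cast; rfl
  · push_cast; ring

theorem cyclic_two_prod_antiIsometric_of_succ (k : ℕ) (a a' : ℤ) (ha' : ¬ (2 : ℤ) ∣ a')
    (h : (4 : ℤ) ∣ a + a') (hc : IsCoprime a (2 ^ k : ℕ)) (hc' : IsCoprime a' (2 ^ (k + 1) : ℕ)) :
    ((cyclic (2 ^ k) a hc).prod (cyclic (2 ^ (k + 1)) a' hc')).Isometric
      (-(cyclic (2 ^ k) a hc).prod (cyclic (2 ^ (k + 1)) a' hc')) := by
  -- With `x = 1` and `c = 2` the equation becomes `a' y² ≡ -a' - 2a`; it is solvable because `8 ∣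
  -- 2(a + a')`.
  obtain ⟨y, hy⟩ := exists_mul_sq_mod_two_pow a' (-a' - 2 * a) ha' (by omega) (k + 1)
  refine cyclic_prod_antiIsometric _ _ 2 (pow_succ' 2 k) a a' hc hc' 1 y ?_
  convert hy using 1
  · push_cast; rfl
  · push_cast; ring

/-- A change of orthogonal basis in two adjacent levels. -/
theorem cyclic_prod_isometric_of_double (N M : ℕ) [NeZero N] [NeZero M] (hM : M = 2 * N)
    (a a' : ℤ) (ha : IsCoprime a N) (ha' : IsCoprime a' M)
    (hb : IsCoprime (a * a' * (a' + 2 * a)) N) (hb' : IsCoprime (a' + 2 * a) M) :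
    ((cyclic N a ha).prod (cyclic M a' ha')).Isometric
      ((cyclic N _ hb).prod (cyclic M _ hb')) := by
  subst hM
  -- The new basis is `(1, 1)`, of norm `(a' + 2a)/(2N)`, and `(a', -2a)`, which is orthogonal to it
  -- and has order dividing `N`.
  refine (cyclic_prod_cyclic_isometric N (2 * N) _ _ hb hb' _
    ((a' : ZMod N), ((-(2 * a) : ℤ) : ZMod (2 * N)))
    (((1 : ℤ) : ZMod N), ((1 : ℤ) : ZMod (2 * N))) ?_ ?_ ?_ ?_ ?_ ?_).symm
  · refine Prod.ext (by simp) ?_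
    change N • ((-(2 * a) : ℤ) : ZMod (2 * N)) = 0
    rw [nsmul_eq_mul, ← Int.cast_natCast (R := ZMod (2 * N)) N, ← Int.cast_mul,
      ZMod.intCast_zmod_eq_zero_iff_dvd]
    exact ⟨-a, by push_cast; ring⟩
  · refine Prod.ext ?_ (by simp)
    change (2 * N) • ((1 : ℤ) : ZMod N) = 0
    simp
  · simp only [prod_toHom, cyclic_toHom_intCast]
    rw [← zmodFrac_mul_left N 2, ← zmodFrac_mul_left N 2, ← map_add, ← Int.cast_add]
    congr 2
    push_cast
    ring
  · simp only [prod_toHom, cyclic_toHom_intCast]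
    rw [← zmodFrac_mul_left N 2, ← map_add, ← Int.cast_add]
    congr 2
    push_cast
    ring
  · simp only [prod_toHom, cyclic_toHom_intCast]
    rw [← zmodFrac_mul_left N 2, ← map_add, ← Int.cast_add]
    convert map_zero (zmodFrac (2 * N)) using 2
    convert Int.cast_zero using 2
    push_cast
    ring
  · simp

theorem evenPlane_toHom_intCast (N : ℕ) [NeZero N] (α β γ : ℤ)
    (h : IsCoprime (4 * (α * γ) - β ^ 2) (N : ℤ)) (x x' y y' : ℤ) :
    (evenPlane N α β γ h).toHom ((x : ZMod N), (x' : ZMod N)) ((y : ZMod N), (y' : ZMod N)) =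
      zmodFrac N ((2 * α * x * y + β * (x * y' + x' * y) + 2 * γ * x' * y' : ℤ) : ZMod N) := by
  rw [evenPlane_toHom]; push_cast; rfl

/-- `α x² + β x y + γ y²` behaves like a norm form: if `θ` sends the generators to `(0, α)` and
`(-γ, β)`, then `s + tθ` multiplies the form by `s² + β s t + αγ t²`. As `β` is odd, Hensel's lemma
finds `s`, `t` for which this factor is `-1`. -/
theorem evenPlane_antiIsometric (k : ℕ) (α β γ : ℤ) (hβ : ¬ (2 : ℤ) ∣ β)
    (h : IsCoprime (4 * (α * γ) - β ^ 2) ((2 ^ k : ℕ) : ℤ)) :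
    (evenPlane (2 ^ k) α β γ h).Isometric (-evenPlane (2 ^ k) α β γ h) := by
  obtain ⟨s, t, hst⟩ : ∃ s t : ℤ, ((2 ^ k : ℕ) : ℤ) ∣ s ^ 2 + β * s * t + α * γ * t ^ 2 + 1 := by
    -- If `αγ` is even, fix `s = 1` and solve for `t`; otherwise fix `t = 1` and solve for `s`. In
    -- both cases `0` is a root mod `2` with derivative `β`.
    by_cases h2 : (2 : ℤ) ∣ α * γ
    · obtain ⟨t, ht⟩ := exists_quadratic_root_mod_prime_pow 2 Nat.prime_two (α * γ) β 2 0
        (by simp) (by simpa using hβ) k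
      exact ⟨1, t, by push_cast; convert ht using 1 <;> push_cast <;> ring⟩
    · obtain ⟨s, hs⟩ := exists_quadratic_root_mod_prime_pow 2 Nat.prime_two 1 β (α * γ + 1) 0
        (by push_cast; omega) (by simpa using hβ) k
      exact ⟨s, 1, by push_cast; convert hs using 1 <;> push_cast <;> ring⟩
  obtain ⟨r, hr⟩ := hst
  refine isometric_of_hom _ _ _ (evenPlane_toHom_zmodHom (2 ^ k) α β γ h _
    ((s : ZMod (2 ^ k)), ((t * α : ℤ) : ZMod (2 ^ k)))
    (((-(t * γ) : ℤ) : ZMod (2 ^ k)), ((s + t * β : ℤ) : ZMod (2 ^ k)))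
    (Prod.ext (by simp) (by simp)) (Prod.ext (by simp) (by simp)) ?_ ?_ ?_) rfl
  · rw [neg_toHom, evenPlane_toHom_intCast, ← map_neg, ← Int.cast_neg, zmodFrac_intCast_eq_iff]
    exact ⟨-(2 * α * r), by linear_combination (-2 * α) * hr⟩
  · rw [neg_toHom, evenPlane_toHom_intCast, ← map_neg, ← Int.cast_neg, zmodFrac_intCast_eq_iff]
    exact ⟨-(β * r), by linear_combination (-β) * hr⟩
  · rw [neg_toHom, evenPlane_toHom_intCast, ← map_neg, ← Int.cast_neg, zmodFrac_intCast_eq_iff]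
    exact ⟨-(2 * γ * r), by linear_combination (-2 * γ) * hr⟩

/-- `2`-primary forms which are even in every level and isometric to their negative. -/
def IsEvenAntiIsometric {D : Type*} [AddCommGroup D] [Finite D] (b : FiniteBilinearForm D) : Prop :=
  (∃ M : ℕ, ∀ x : D, 2 ^ M • x = 0) ∧
    (∀ (j : ℕ) (x : D), 2 ^ (j + 1) • x = 0 → 2 ^ j • b.toHom x x = 0) ∧ b.Isometric (-b)

theorem evenPlane_isEvenAntiIsometric (k : ℕ) (α β γ : ℤ) (hβ : ¬ (2 : ℤ) ∣ β)
    (h : IsCoprime (4 * (α * γ) - β ^ 2) ((2 ^ k : ℕ) : ℤ)) :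
    (evenPlane (2 ^ k) α β γ h).IsEvenAntiIsometric := by
  refine ⟨⟨k, fun x => ?_⟩, fun j x hx => ?_, evenPlane_antiIsometric k α β γ hβ h⟩
  · have : ((2 : ZMod (2 ^ k)) ^ k) = 0 := by
      have := ZMod.natCast_self (2 ^ k)
      rwa [Nat.cast_pow] at this
    refine Prod.ext ?_ ?_ <;> simp [nsmul_eq_mul, this]
  · have h1 : (2 : ZMod (2 ^ k)) ^ (j + 1) * x.1 = 0 := by
      have := congrArg Prod.fst hx
      simpa [nsmul_eq_mul] using this
    have h2 : (2 : ZMod (2 ^ k)) ^ (j + 1) * x.2 = 0 := by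
      have := congrArg Prod.snd hx
      simpa [nsmul_eq_mul] using this
    rw [evenPlane_toHom, nsmul_zmodFrac]
    convert map_zero (zmodFrac (2 ^ k)) using 2
    push_cast
    linear_combination (α * x.1 + β * x.2) * h1 + γ * x.2 * h2

/-- The vector `(1, 1, 1)` has norm `a + b + c`. Its complement is spanned by `(b, -a, 0)` and `(0,
c, -b)`, whose norms `ab(a + b)` and `bc(b + c)` are even and whose product `-abc` is odd, so it is
an even plane. -/
theorem cyclic_prod_prod_isometric (k : ℕ) (a b c : ℤ) (ha : ¬ (2 : ℤ) ∣ a) (hb : ¬ (2 : ℤ) ∣ b)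
    (hc : ¬ (2 : ℤ) ∣ c) (ha' : IsCoprime a (2 ^ k : ℕ)) (hb' : IsCoprime b (2 ^ k : ℕ))
    (hc' : IsCoprime c (2 ^ k : ℕ)) (hs : IsCoprime (a + b + c) (2 ^ k : ℕ)) :
    ∃ e : FiniteBilinearForm (ZMod (2 ^ k) × ZMod (2 ^ k)), e.IsEvenAntiIsometric ∧
      ((cyclic (2 ^ k) a ha').prod ((cyclic (2 ^ k) b hb').prod (cyclic (2 ^ k) c hc'))).Isometric
        ((cyclic (2 ^ k) (a + b + c) hs).prod e) := by
  obtain ⟨m, hm⟩ : (2 : ℤ) ∣ a + b := by omega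
  obtain ⟨n, hn⟩ : (2 : ℤ) ∣ b + c := by omega
  have hβ : ¬ (2 : ℤ) ∣ -(a * b * c) := by
    rw [dvd_neg]
    exact Int.prime_two.not_dvd_mul (Int.prime_two.not_dvd_mul ha hb) hc
  have hcop : IsCoprime (4 * ((a * b * m) * (b * c * n)) - (-(a * b * c)) ^ 2) ((2 ^ k : ℕ) : ℤ) := by
    apply isCoprime_two_pow
    intro h
    apply hβ
    rw [dvd_sub_right (Dvd.intro _ (show (2 : ℤ) * (2 * ((a * b * m) * (b * c * n))) = _ by ring))]
      at h
    exact Int.prime_two.dvd_of_dvd_pow h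
  refine ⟨evenPlane (2 ^ k) _ _ _ hcop, evenPlane_isEvenAntiIsometric k _ _ _ hβ hcop,
    Isometric.symm ?_⟩
  set D := ((cyclic (2 ^ k) a ha').prod ((cyclic (2 ^ k) b hb').prod (cyclic (2 ^ k) c hc'))) with hD
  have key : ∀ x y z x' y' z' : ℤ, D.toHom
      ((x : ZMod (2 ^ k)), (y : ZMod (2 ^ k)), (z : ZMod (2 ^ k)))
      ((x' : ZMod (2 ^ k)), (y' : ZMod (2 ^ k)), (z' : ZMod (2 ^ k))) =
      zmodFrac (2 ^ k) ((a * x * x' + b * y * y' + c * z * z' : ℤ) : ZMod (2 ^ k)) := by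
    intro x y z x' y' z'
    simp only [hD, prod_toHom, cyclic_toHom_intCast, ← map_add, ← Int.cast_add]
    congr 2
    ring
  let v : ZMod (2 ^ k) × ZMod (2 ^ k) × ZMod (2 ^ k) :=
    (((1 : ℤ) : ZMod (2 ^ k)), ((1 : ℤ) : ZMod (2 ^ k)), ((1 : ℤ) : ZMod (2 ^ k)))
  let w : ZMod (2 ^ k) × ZMod (2 ^ k) × ZMod (2 ^ k) :=
    ((b : ZMod (2 ^ k)), ((-a : ℤ) : ZMod (2 ^ k)), ((0 : ℤ) : ZMod (2 ^ k)))
  let w' : ZMod (2 ^ k) × ZMod (2 ^ k) × ZMod (2 ^ k) :=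
    (((0 : ℤ) : ZMod (2 ^ k)), (c : ZMod (2 ^ k)), ((-b : ℤ) : ZMod (2 ^ k)))
  have h0 : ∀ x : ZMod (2 ^ k) × ZMod (2 ^ k) × ZMod (2 ^ k), (2 ^ k) • x = 0 := fun x =>
    ZModModule.char_nsmul_eq_zero _ x
  have hvw : D.toHom v w = 0 := by
    rw [key]; convert map_zero (zmodFrac (2 ^ k)); convert Int.cast_zero; ring
  have hvw' : D.toHom v w' = 0 := by
    rw [key]; convert map_zero (zmodFrac (2 ^ k)); convert Int.cast_zero; ring
  refine isometric_prod_of_orthogonal _ _ _ (zmodHom _ v (h0 v))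
    ((zmodHom _ w (h0 w)).coprod (zmodHom _ w' (h0 w')))
    (cyclic_toHom_zmodHom _ _ _ _ _ _ ?_) (evenPlane_toHom_zmodHom _ _ _ _ _ _ _ _ _ _ ?_ ?_ ?_)
    (fun x y => ?_) (by simp)
  · rw [key]; congr 2; ring
  · rw [key]; congr 2; linear_combination a * b * hm
  · rw [key]; congr 2; ring
  · rw [key]; congr 2; linear_combination c * b * hn
  · rw [AddMonoidHom.coprod_apply, map_add, toHom_zmodHom_zmodHom_eq_zero _ _ _ _ _ _ _ hvw,
      toHom_zmodHom_zmodHom_eq_zero _ _ _ _ _ _ _ hvw', add_zero]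

end FiniteBilinearForm

/-! ### Decomposition into cyclic blocks and an even part -/

/-- The data of a non-degenerate form `a x y / p^k` on `ℤ/p^k`. -/
structure CyclicBlock where
  p : ℕ
  k : ℕ
  a : ℤ
  prime : p.Prime
  k_ne_zero : k ≠ 0
  not_dvd : ¬ (p : ℤ) ∣ a

namespace CyclicBlock

instance (c : CyclicBlock) : NeZero (c.p ^ c.k) := ⟨pow_ne_zero _ c.prime.ne_zero⟩

theorem isCoprime (c : CyclicBlock) : IsCoprime c.a ((c.p ^ c.k : ℕ) : ℤ) := by
  push_cast
  exact (((Nat.prime_iff_prime_int.1 c.prime).coprime_iff_not_dvd.2 c.not_dvd).symm).pow_right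

/-- The form `a x y / p^k` on `ℤ/p^k`. -/
noncomputable def form (c : CyclicBlock) : FiniteBilinearForm (ZMod (c.p ^ c.k)) :=
  FiniteBilinearForm.cyclic (c.p ^ c.k) c.a c.isCoprime

theorem form_toHom (c : CyclicBlock) (x y : ZMod (c.p ^ c.k)) :
    c.form.toHom x y = zmodFrac (c.p ^ c.k) (c.a * x * y) := rfl

end CyclicBlock

/-! ### Orthogonal sums indexed by lists of blocks, and their existence -/

namespace FiniteBilinearForm

universe u

/-- `b` is an orthogonal sum of the blocks in `L` and of a form which is even in every level and
isometric to its negative. -/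
def HasBlocks : List CyclicBlock → ∀ {D : Type u} [AddCommGroup D] [Finite D],
    FiniteBilinearForm D → Prop
  | [], _, _, _, b => b.IsEvenAntiIsometric
  | c :: L, _, _, _, b => ∃ (D' : Type u) (_ : AddCommGroup D') (_ : Finite D')
      (b' : FiniteBilinearForm D'), HasBlocks L b' ∧ b.Isometric (c.form.prod b')

theorem IsEvenAntiIsometric.congr {D D' : Type*} [AddCommGroup D] [Finite D] [AddCommGroup D']
    [Finite D'] {b : FiniteBilinearForm D} {b' : FiniteBilinearForm D'} (h : b.Isometric b')
    (hb : b.IsEvenAntiIsometric) : b'.IsEvenAntiIsometric := by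
  obtain ⟨f, hf⟩ := h.symm
  obtain ⟨⟨M, hM⟩, he, hn⟩ := hb
  refine ⟨⟨M, fun x => ?_⟩, fun j x hx => ?_, h.symm.antiIsometric hn⟩
  · rw [← map_eq_zero_iff f f.injective, map_nsmul, hM]
  · rw [hf, he]
    rw [← map_nsmul, hx, map_zero]

theorem IsEvenAntiIsometric.prod {D D' : Type*} [AddCommGroup D] [Finite D] [AddCommGroup D']
    [Finite D'] {b : FiniteBilinearForm D} {b' : FiniteBilinearForm D'}
    (hb : b.IsEvenAntiIsometric) (hb' : b'.IsEvenAntiIsometric) :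
    (b.prod b').IsEvenAntiIsometric := by
  obtain ⟨⟨M, hM⟩, he, hn⟩ := hb
  obtain ⟨⟨M', hM'⟩, he', hn'⟩ := hb'
  refine ⟨⟨M + M', fun x => Prod.ext ?_ ?_⟩, fun j x hx => ?_, antiIsometric_prod hn hn'⟩
  · rw [pow_add, mul_comm, mul_smul, Prod.smul_fst, Prod.smul_fst, hM, smul_zero, Prod.fst_zero]
  · rw [pow_add, mul_smul, Prod.smul_snd, Prod.smul_snd, hM', smul_zero, Prod.snd_zero]
  · rw [prod_toHom, smul_add, he j x.1 (congrArg Prod.fst hx), he' j x.2 (congrArg Prod.snd hx),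
      add_zero]

section

variable {D D' : Type u} [AddCommGroup D] [Finite D] [AddCommGroup D'] [Finite D']

theorem HasBlocks.congr {b : FiniteBilinearForm D} {b' : FiniteBilinearForm D'}
    (h : b.Isometric b') : ∀ {L : List CyclicBlock}, HasBlocks L b → HasBlocks L b'
  | [], hb => IsEvenAntiIsometric.congr h hb
  | _ :: _, ⟨A, i, j, a, ha, hb⟩ => ⟨A, i, j, a, ha, h.symm.trans hb⟩

theorem HasBlocks.perm {L L' : List CyclicBlock} (h : L.Perm L') :
    ∀ {D : Type u} [AddCommGroup D] [Finite D] {b : FiniteBilinearForm D},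
      HasBlocks L b → HasBlocks L' b := by
  induction h with
  | nil => exact fun h => h
  | cons c _ ih =>
    rintro D _ _ b ⟨A, i, j, a, ha, hb⟩
    exact ⟨A, i, j, a, ih ha, hb⟩
  | swap c d L =>
    rintro D _ _ b ⟨A, _, _, a, ⟨B, _, _, b', hb', ha⟩, hb⟩
    exact ⟨_, _, inferInstance, d.form.prod b', ⟨B, _, inferInstance, b', hb', Isometric.refl _⟩,
      (hb.trans ((Isometric.refl _).prod ha)).trans (prod_left_comm _ _ _)⟩
  | trans _ _ ih ih' => exact fun h => ih' (ih h)

theorem HasBlocks.replace {c d c' d' : CyclicBlock}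
    (h : (c.form.prod d.form).Isometric (c'.form.prod d'.form)) {L : List CyclicBlock}
    {b : FiniteBilinearForm D} (hb : HasBlocks (c :: d :: L) b) :
    HasBlocks (c' :: d' :: L) b := by
  obtain ⟨A, _, _, a, ⟨B, _, _, b', hb', ha⟩, hb⟩ := hb
  exact ⟨_, _, inferInstance, d'.form.prod b', ⟨B, _, inferInstance, b', hb', Isometric.refl _⟩,
    ((hb.trans ((Isometric.refl _).prod ha)).trans (prod_assoc _ _ _).symm).trans
      ((h.prod (Isometric.refl _)).trans (prod_assoc _ _ _))⟩

theorem HasBlocks.even_prod {E : Type*} [AddCommGroup E] [Finite E] {e : FiniteBilinearForm E}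
    (he : e.IsEvenAntiIsometric) : ∀ {L : List CyclicBlock} {D : Type*} [AddCommGroup D] [Finite D]
      {b : FiniteBilinearForm D}, HasBlocks L b → HasBlocks L (e.prod b)
  | [], _, _, _, _, hb => he.prod hb
  | _ :: _, _, _, _, _, ⟨A, _, _, a, ha, hb⟩ =>
    ⟨E × A, inferInstance, inferInstance, e.prod a, HasBlocks.even_prod he ha,
      ((Isometric.refl e).prod hb).trans (prod_left_comm _ _ _)⟩

end

/-- Take `p^k` to be the exponent of the `p`-primary part. Some element of that part is not killed
by `p^(k-1)`, and non-degeneracy gives it a partner. Multiplying by the prime-to-`p` part `r` of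
`|D|` moves both into the `p`-primary part without losing the pairing. -/
theorem exists_nsmul_toHom_ne_zero {D : Type*} [AddCommGroup D] [Finite D]
    (b : FiniteBilinearForm D) (p : ℕ) [Fact p.Prime] (hp : p ∣ Nat.card D) :
    ∃ k ≠ 0, ∃ x y : D, p ^ k • x = 0 ∧ p ^ k • y = 0 ∧ p ^ (k - 1) • b.toHom x y ≠ 0 := by
  classical
  have hp' : p.Prime := Fact.out
  let _ : Fintype D := Fintype.ofFinite D
  obtain ⟨x₀, hx₀⟩ := exists_prime_addOrderOf_dvd_card (G := D) p
    (by rwa [← Nat.card_eq_fintype_card])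
  obtain ⟨M, r, hr, hM⟩ : ∃ M r : ℕ, ¬ p ∣ r ∧ Nat.card D = p ^ M * r :=
    Nat.exists_eq_pow_mul_and_not_dvd Nat.card_pos.ne' p hp'.ne_one
  have hcop : Nat.Coprime r p := ((Nat.Prime.coprime_iff_not_dvd hp').2 hr).symm
  have hex : ∃ n, ∀ z : D, p ^ n • r • z = 0 := ⟨M, fun z => by
    rw [← mul_smul, ← hM, card_nsmul_eq_zero']⟩
  have hk0 : Nat.find hex ≠ 0 := by
    intro h0
    have h1 := Nat.find_spec hex x₀
    rw [h0, pow_zero, one_smul] at h1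
    have h2 := addOrderOf_dvd_of_nsmul_eq_zero h1
    rw [hx₀] at h2
    exact hr h2
  set k := Nat.find hex with hk
  have hmin : ¬ ∀ z : D, p ^ (k - 1) • r • z = 0 := Nat.find_min hex (by omega)
  push Not at hmin
  obtain ⟨z, hz⟩ := hmin
  have h3 : ∃ w, b.toHom (p ^ (k - 1) • r • z) w ≠ 0 := by
    by_contra! h
    exact hz (b.nondegenerate _ h)
  obtain ⟨w, hw⟩ := h3
  refine ⟨k, hk0, r • z, r • w, Nat.find_spec hex z, Nat.find_spec hex w, fun h => hw ?_⟩
  rw [map_nsmul] at h ⊢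
  set t := b.toHom (r • z) w
  rw [AddMonoidHom.nsmul_apply]
  change p ^ (k - 1) • t = 0
  have h4 : r • p ^ (k - 1) • t = 0 := by rw [smul_comm]; exact h
  have h5 : p • p ^ (k - 1) • t = 0 := by
    rw [← mul_smul, ← pow_succ', Nat.sub_add_cancel (Nat.one_le_iff_ne_zero.2 hk0),
      ← AddMonoidHom.nsmul_apply, ← map_nsmul, Nat.find_spec hex z, map_zero,
      AddMonoidHom.zero_apply]
  rw [← addOrderOf_dvd_iff_nsmul_eq_zero] at h4 h5
  exact AddMonoid.addOrderOf_eq_one_iff.1 (Nat.eq_one_of_dvd_coprimes hcop h4 h5)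

theorem exists_zmodFrac_of_nsmul_ne_zero (p k : ℕ) [Fact p.Prime] (hk : k ≠ 0)
    (t : AddCircle (1 : ℚ)) (h : p ^ k • t = 0) (h' : p ^ (k - 1) • t ≠ 0) :
    ∃ a : ℤ, t = zmodFrac (p ^ k) a ∧ ¬ (p : ℤ) ∣ a := by
  obtain ⟨a, rfl⟩ := exists_zmodFrac_eq (p ^ k) t h
  refine ⟨a, rfl, ?_⟩
  rintro ⟨c, rfl⟩
  apply h'
  rw [nsmul_zmodFrac, zmodFrac_eq_zero_iff, ← Int.cast_natCast, ← Int.cast_mul,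
    ZMod.intCast_zmod_eq_zero_iff_dvd]
  refine ⟨c, ?_⟩
  obtain ⟨k, rfl⟩ := Nat.exists_eq_succ_of_ne_zero hk
  push_cast
  simp only [Nat.succ_eq_add_one]
  ring

theorem exists_zmodFrac_of_nsmul_eq_zero (p k : ℕ) [Fact p.Prime] (hk : k ≠ 0)
    (t : AddCircle (1 : ℚ)) (h' : p ^ (k - 1) • t = 0) :
    ∃ a : ℤ, t = zmodFrac (p ^ k) (p * a : ℤ) := by
  obtain ⟨a, rfl⟩ := exists_zmodFrac_eq (p ^ (k - 1)) t h'
  refine ⟨a, ?_⟩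
  obtain ⟨k, rfl⟩ := Nat.exists_eq_succ_of_ne_zero hk
  have : NeZero (p * p ^ k) := ⟨mul_ne_zero (NeZero.ne p) (NeZero.ne _)⟩
  rw [zmodFrac_intCast, zmodFrac_intCast]
  have hp : (p : ℚ) ≠ 0 := Nat.cast_ne_zero.2 (NeZero.ne p)
  congr 1
  push_cast
  rw [pow_succ', mul_div_mul_left _ _ hp]

/-- Induction on the order. At the exponent `p^k` of the `p`-part, an element whose norm has full
order `p^k` splits off a cyclic block. If there is none, polarization forces `p = 2`, and a pair
with pairing of full order spans an even plane, which goes into the even part. -/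
theorem exists_hasBlocks (n : ℕ) : ∀ {D : Type u} [AddCommGroup D] [Finite D]
    (b : FiniteBilinearForm D), Nat.card D = n → ∃ L, HasBlocks L b := by
  induction n using Nat.strong_induction_on with | _ n ih =>
  intro D _ _ b hn
  rcases Nat.lt_or_ge 1 n with h1 | h1
  · obtain ⟨p, hp, hpn⟩ := Nat.exists_prime_and_dvd h1.ne'
    have : Fact p.Prime := ⟨hp⟩
    obtain ⟨k, hk, x, y, hx, hy, hxy⟩ := b.exists_nsmul_toHom_ne_zero p (hn ▸ hpn)
    have hb : ∀ u v : D, p ^ k • u = 0 → p ^ k • b.toHom u v = 0 := fun u v hu => by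
      rw [← AddMonoidHom.nsmul_apply, ← map_nsmul, hu, map_zero, AddMonoidHom.zero_apply]
    have hlt : ∀ (m : ℕ) (K : AddSubgroup D), m * Nat.card K = Nat.card D → p ^ k ≤ m →
        Nat.card K < n := fun m K hm hpm => by
      have h2 : 1 < p ^ k := Nat.one_lt_pow hk hp.one_lt
      rw [← hn, ← hm]
      exact lt_mul_of_one_lt_left Nat.card_pos (h2.trans_le hpm)
    by_cases hz : ∃ z : D, p ^ k • z = 0 ∧ p ^ (k - 1) • b.toHom z z ≠ 0
    · obtain ⟨z, hz, hzz⟩ := hz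
      obtain ⟨a, ha, hpa⟩ := exists_zmodFrac_of_nsmul_ne_zero p k hk _ (hb z z hz) hzz
      let c : CyclicBlock := ⟨p, k, a, hp, hk, hpa⟩
      obtain ⟨K, b', hK⟩ := exists_isometric_prod c.form b (zmodHom (p ^ k) z hz)
        (cyclic_toHom_zmodHom _ _ _ b z hz ha)
      have hcard : p ^ k * Nat.card K = Nat.card D := by
        obtain ⟨f, -⟩ := hK
        rw [Nat.card_congr f.toEquiv, Nat.card_prod]
        simp [c]
      obtain ⟨L, hL⟩ := ih _ (hlt _ K hcard le_rfl) b' rfl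
      exact ⟨c :: L, K, _, inferInstance, b', hL, hK⟩
    · push Not at hz
      have hp2 : p = 2 := by
        by_contra hp2
        -- All three norms vanish after multiplication by `p^(k-1)`, so twice the pairing of `x` and
        -- `y` does too; for odd `p` the pairing itself would vanish.
        have h2 := hz (x + y) (by rw [smul_add, hx, hy, add_zero])
        simp only [map_add, AddMonoidHom.add_apply, smul_add, hz x hx, hz y hy, b.symm y x] at h2
        rw [zero_add, add_zero, ← two_nsmul] at h2
        have h3 : p • p ^ (k - 1) • b.toHom x y = 0 := by
          rw [← mul_smul, ← pow_succ', Nat.sub_add_cancel (Nat.one_le_iff_ne_zero.2 hk), hb x y hx]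
        rw [← addOrderOf_dvd_iff_nsmul_eq_zero] at h2 h3
        exact hxy (AddMonoid.addOrderOf_eq_one_iff.1 (Nat.eq_one_of_dvd_coprimes
          ((Nat.coprime_primes Nat.prime_two hp).2 (Ne.symm hp2)) h2 h3))
      subst hp2
      obtain ⟨β, hβ, hβ2⟩ := exists_zmodFrac_of_nsmul_ne_zero 2 k hk _ (hb x y hx) hxy
      obtain ⟨α, hα⟩ := exists_zmodFrac_of_nsmul_eq_zero 2 k hk _ (hz x hx)
      obtain ⟨γ, hγ⟩ := exists_zmodFrac_of_nsmul_eq_zero 2 k hk _ (hz y hy)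
      have hβ2 : ¬ (2 : ℤ) ∣ β := hβ2
      have hcop : IsCoprime (4 * (α * γ) - β ^ 2) ((2 ^ k : ℕ) : ℤ) := by
        apply isCoprime_two_pow
        intro h
        rw [dvd_sub_right (Dvd.intro _ (show (2 : ℤ) * (2 * (α * γ)) = _ by ring))] at h
        exact hβ2 (Int.prime_two.dvd_of_dvd_pow h)
      obtain ⟨K, b', hK⟩ := exists_isometric_prod (evenPlane (2 ^ k) α β γ hcop) b _
        (evenPlane_toHom_zmodHom (2 ^ k) α β γ hcop b x y hx hy hα hβ hγ)
      have hcard : 2 ^ k * 2 ^ k * Nat.card K = Nat.card D := by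
        obtain ⟨f, -⟩ := hK
        rw [Nat.card_congr f.toEquiv, Nat.card_prod, Nat.card_prod]
        simp
      obtain ⟨L, hL⟩ := ih _ (hlt _ K hcard (Nat.le_mul_of_pos_left _ (by positivity))) b' rfl
      exact ⟨L, HasBlocks.congr hK.symm
        (HasBlocks.even_prod (evenPlane_isEvenAntiIsometric k α β γ hβ2 hcop) hL)⟩
  · have : Subsingleton D := Finite.card_le_one_iff_subsingleton.1 (hn.trans_le h1)
    refine ⟨[], ⟨0, fun x => Subsingleton.elim _ _⟩, fun j x _ => ?_, AddEquiv.refl D, fun x y => ?_⟩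
    · rw [Subsingleton.elim x 0, map_zero, smul_zero]
    · rw [Subsingleton.elim x 0]; simp

end FiniteBilinearForm

/-! ### Anti-isometries from conditions on the blocks -/

namespace CyclicBlock

/-- The number of blocks `ℤ/p^k`. -/
def blockRank (L : List CyclicBlock) (p k : ℕ) : ℕ :=
  L.countP fun c => c.p = p ∧ c.k = k

/-- The contribution of a block to the Gauss sum of level `j`. -/
def oddity (j : ℕ) (c : CyclicBlock) : ℤ := if c.p = 2 ∧ j < c.k then c.a else 0

/-- The sum of the numerators of all blocks `ℤ/2^k` with `k > j`. -/
def totalOddity (L : List CyclicBlock) (j : ℕ) : ℤ := (L.map (oddity j)).sum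

/-- The oddity condition in the levels without blocks. -/
def OddityCondition (L : List CyclicBlock) : Prop :=
  ∀ j ≠ 0, (∀ c ∈ L, c.p = 2 → c.k ≠ j) → (4 : ℤ) ∣ totalOddity L j

/-- For `p ≡ 3 mod 4` the number of blocks `ℤ/p^k` is even. -/
def ParityCondition (L : List CyclicBlock) : Prop :=
  ∀ p k, p % 4 = 3 → Even (blockRank L p k)

theorem totalOddity_cons (c : CyclicBlock) (L : List CyclicBlock) (j : ℕ) :
    totalOddity (c :: L) j = oddity j c + totalOddity L j := by simp [totalOddity]

theorem blockRank_cons (c : CyclicBlock) (L : List CyclicBlock) (p k : ℕ) :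
    blockRank (c :: L) p k = blockRank L p k + if c.p = p ∧ c.k = k then 1 else 0 := by
  simp [blockRank, List.countP_cons]

theorem OddityCondition.perm {L L' : List CyclicBlock} (h : L.Perm L') (hL : OddityCondition L) :
    OddityCondition L' := fun j hj hj' => by
  rw [totalOddity, ← (h.map _).sum_eq]
  exact hL j hj fun c hc => hj' c (h.mem_iff.1 hc)

theorem ParityCondition.perm {L L' : List CyclicBlock} (h : L.Perm L') (hL : ParityCondition L) :
    ParityCondition L' := fun p k hp => by
  rw [blockRank, ← h.countP_eq]
  exact hL p k hp

theorem oddity_of_le {j : ℕ} {c : CyclicBlock} (h : c.k ≤ j) : oddity j c = 0 :=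
  if_neg fun h' => absurd h'.2 (not_lt.2 h)

theorem oddity_of_ne {j : ℕ} {c : CyclicBlock} (h : c.p ≠ 2) : oddity j c = 0 :=
  if_neg fun h' => h h'.1

theorem oddity_of_lt {j : ℕ} {c : CyclicBlock} (hp : c.p = 2) (h : j < c.k) : oddity j c = c.a :=
  if_pos ⟨hp, h⟩

theorem totalOddity_of_le {j : ℕ} {L : List CyclicBlock} (h : ∀ c ∈ L, c.k ≤ j) :
    totalOddity L j = 0 := by
  induction L with
  | nil => rfl
  | cons c L ih =>
    rw [totalOddity_cons, oddity_of_le (h c (by simp)), ih fun d hd => h d (by simp [hd]), add_zero]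

theorem not_two_dvd {c : CyclicBlock} (h : c.p = 2) : ¬ (2 : ℤ) ∣ c.a := by
  have := c.not_dvd
  rwa [h] at this

theorem exists_perm_max (L : List CyclicBlock) (hL : L ≠ []) :
    ∃ c L', L.Perm (c :: L') ∧ ∀ d ∈ L', d.k ≤ c.k := by
  induction L with
  | nil => exact absurd rfl hL
  | cons c L ih =>
    by_cases h : L = []
    · subst h; exact ⟨c, [], List.Perm.refl _, by simp⟩
    · obtain ⟨d, L', hp, hd⟩ := ih h
      rcases le_total d.k c.k with h1 | h1
      · refine ⟨c, d :: L', hp.cons c, fun e he => ?_⟩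
        rcases List.mem_cons.1 he with rfl | he
        · exact h1
        · exact (hd e he).trans h1
      · refine ⟨d, c :: L', (hp.cons c).trans (List.Perm.swap _ _ _), fun e he => ?_⟩
        rcases List.mem_cons.1 he with rfl | he
        · exact h1
        · exact hd e he

theorem form_antiIsometric_of_one_mod_four (c : CyclicBlock) (h : c.p % 4 = 1) :
    c.form.Isometric (-c.form) := by
  have : Fact c.p.Prime := ⟨c.prime⟩
  obtain ⟨s, hs⟩ := exists_sq_add_one_mod_prime_pow c.p h c.k
  refine FiniteBilinearForm.cyclic_antiIsometric _ _ _ s ?_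
  rw [show c.a * s ^ 2 + c.a = c.a * (s ^ 2 + 1) by ring]
  push_cast
  exact hs.mul_left _

theorem form_prod_antiIsometric_of_odd (c d : CyclicBlock) (h : c.p ≠ 2) (hp : c.p = d.p)
    (hk : c.k = d.k) : (c.form.prod d.form).Isometric (-c.form.prod d.form) := by
  obtain ⟨p, k, a, hp1, hk1, ha⟩ := c
  obtain ⟨p', k', a', hp2, hk2, ha'⟩ := d
  simp only at hp hk h
  subst hp hk
  have : Fact p.Prime := ⟨hp1⟩
  obtain ⟨x, y, hxy⟩ := exists_binary_form_mod_prime_pow p h a a' ha ha' k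
  refine FiniteBilinearForm.cyclic_prod_antiIsometric _ _ 1 (one_mul _).symm a a' _ _ x y ?_
  convert hxy using 1
  · push_cast; rfl
  · push_cast; ring

theorem form_antiIsometric_of_level_one (c : CyclicBlock) (h : c.p = 2) (hk : c.k = 1) :
    c.form.Isometric (-c.form) := by
  obtain ⟨p, k, a, hp1, hk1, ha⟩ := c
  simp only at h hk
  subst h hk
  refine FiniteBilinearForm.cyclic_antiIsometric _ _ _ 1 ⟨a, ?_⟩
  push_cast
  ring

theorem form_prod_antiIsometric_of_four_dvd (c d : CyclicBlock) (hc : c.p = 2) (hd : d.p = 2)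
    (hk : d.k = c.k ∨ d.k = c.k + 1) (h : (4 : ℤ) ∣ c.a + d.a) :
    (c.form.prod d.form).Isometric (-c.form.prod d.form) := by
  obtain ⟨p, k, a, hp1, hk1, ha⟩ := c
  obtain ⟨p', k', a', hp2, hk2, ha'⟩ := d
  simp only at hc hd hk h
  subst hc hd
  rcases hk with rfl | rfl
  · exact FiniteBilinearForm.cyclic_two_prod_antiIsometric_of_eq _ a a' ha h _ _
  · exact FiniteBilinearForm.cyclic_two_prod_antiIsometric_of_succ _ a a' ha' h _ _

/-- The block with negated numerator. -/
def neg (c : CyclicBlock) : CyclicBlock :=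
  ⟨c.p, c.k, -c.a, c.prime, c.k_ne_zero, by rw [dvd_neg]; exact c.not_dvd⟩

theorem form_isometric_neg_of_level_one (c : CyclicBlock) (h : c.p = 2) (hk : c.k = 1) :
    c.form.Isometric c.neg.form := by
  refine FiniteBilinearForm.cyclic_congr _ _ _ _ _ ⟨c.a, ?_⟩
  rw [h, hk, neg]
  push_cast
  ring

/-- In level `1` the sign of a numerator is immaterial. Both numerators are odd, so flipping one
turns a sum `≡ 2` mod `4` into a sum divisible by `4`. -/
theorem form_prod_antiIsometric_of_two (c d : CyclicBlock) (hc : c.p = 2) (hd : d.p = 2)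
    (hk : d.k = c.k ∨ d.k = c.k + 1) (h : (4 : ℤ) ∣ c.a + d.a ∨ c.k = 1) :
    (c.form.prod d.form).Isometric (-c.form.prod d.form) := by
  by_cases h4 : (4 : ℤ) ∣ c.a + d.a
  · exact form_prod_antiIsometric_of_four_dvd c d hc hd hk h4
  · have h1 := h.resolve_left h4
    refine ((form_isometric_neg_of_level_one c hc h1).prod
      (FiniteBilinearForm.Isometric.refl _)).antiIsometric
      (form_prod_antiIsometric_of_four_dvd c.neg d hc hd hk ?_)
    have h2 := not_two_dvd hc
    have h3 := not_two_dvd hd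
    change (4 : ℤ) ∣ -c.a + d.a
    omega

/-- Since `a b (b + 2a) ≡ a + 2` and `b + 2a ≡ b + 2` mod `4` for odd `a`, `b`, the change of basis
`cyclic_prod_isometric_of_double` shifts both numerators by `2` mod `4` and leaves their sum
unchanged mod `4`. -/
theorem exists_double (c d : CyclicBlock) (hc : c.p = 2) (hd : d.p = 2) (hk : d.k = c.k + 1) :
    ∃ c' d' : CyclicBlock, c'.p = 2 ∧ d'.p = 2 ∧ c'.k = c.k ∧ d'.k = d.k ∧
      (4 : ℤ) ∣ c'.a - c.a - 2 ∧ (4 : ℤ) ∣ d'.a - d.a - 2 ∧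
      (c.form.prod d.form).Isometric (c'.form.prod d'.form) := by
  have h2 := not_two_dvd hc
  have h3 := not_two_dvd hd
  obtain ⟨p, k, a, hp1, hk1, ha⟩ := c
  obtain ⟨p', k', b, hp2, hk2, hb⟩ := d
  simp only at hc hd hk h2 h3
  subst hc hd hk
  have h4 : ¬ (2 : ℤ) ∣ b + 2 * a := by omega
  have h5 : ¬ (2 : ℤ) ∣ a * b * (b + 2 * a) :=
    Int.prime_two.not_dvd_mul (Int.prime_two.not_dvd_mul h2 h3) h4
  refine ⟨⟨2, k, _, hp1, hk1, h5⟩, ⟨2, k + 1, _, hp2, hk2, h4⟩, rfl, rfl, rfl, rfl, ?_, ?_,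
    FiniteBilinearForm.cyclic_prod_isometric_of_double _ _ (pow_succ' 2 k) a b _ _ _ _⟩
  · obtain ⟨s, hs⟩ : (2 : ℤ) ∣ a - 1 := by omega
    obtain ⟨t, ht⟩ : (2 : ℤ) ∣ b - 1 := by omega
    obtain rfl : a = 2 * s + 1 := by linarith
    obtain rfl : b = 2 * t + 1 := by linarith
    refine ⟨(2 * s + 1) * (t ^ 2 + t) + (2 * s ^ 2 + 2 * s) * (2 * t + 1) + t, ?_⟩
    ring
  · change (4 : ℤ) ∣ b + 2 * a - b - 2
    omega

end CyclicBlock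

/-! ### Merging three blocks, and splitting off anti-isometric summands -/

namespace FiniteBilinearForm

open CyclicBlock

universe u

section

variable {D : Type u} [AddCommGroup D] [Finite D]

/-- The even plane left over by `cyclic_prod_prod_isometric` is absorbed into the even part of the
decomposition. -/
theorem HasBlocks.exists_sum {c d e : CyclicBlock} (hc : c.p = 2) (hd : d.p = 2) (he : e.p = 2)
    (hcd : d.k = c.k) (hce : e.k = c.k) {L : List CyclicBlock} {b : FiniteBilinearForm D}
    (hb : HasBlocks (c :: d :: e :: L) b) :
    ∃ s : CyclicBlock, s.p = 2 ∧ s.k = c.k ∧ s.a = c.a + d.a + e.a ∧ HasBlocks (s :: L) b := by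
  have h1 := not_two_dvd hc
  have h2 := not_two_dvd hd
  have h3 := not_two_dvd he
  obtain ⟨A, _, _, a, ⟨A', _, _, a', ⟨B, _, _, b', hb', ha'⟩, ha⟩, hb⟩ := hb
  obtain ⟨p, k, x, hp1, hk1, hx⟩ := c
  obtain ⟨p', k', y, hp2, hk2, hy⟩ := d
  obtain ⟨p'', k'', z, hp3, hk3, hz⟩ := e
  simp only at hc hd he hcd hce h1 h2 h3
  subst hc hd he hcd hce
  have h4 : ¬ (2 : ℤ) ∣ x + y + z := by omega
  let s : CyclicBlock := ⟨2, k'', x + y + z, hp1, hk1, h4⟩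
  obtain ⟨e, he, hiso⟩ := cyclic_prod_prod_isometric k'' x y z h1 h2 h3 (isCoprime_two_pow h1 _)
    (isCoprime_two_pow h2 _) (isCoprime_two_pow h3 _) (isCoprime_two_pow h4 _)
  refine ⟨s, rfl, rfl, rfl, _, inferInstance, inferInstance, e.prod b', hb'.even_prod he, ?_⟩
  refine hb.trans (((Isometric.refl _).prod (ha.trans ((Isometric.refl _).prod ha'))).trans ?_)
  exact (((Isometric.refl _).prod (prod_assoc _ _ _).symm).trans
    (prod_assoc _ _ _).symm).trans ((hiso.prod (Isometric.refl _)).trans (prod_assoc _ _ _))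

theorem HasBlocks.antiIsometric_cons {c : CyclicBlock} {L : List CyclicBlock}
    {b : FiniteBilinearForm D} (hb : HasBlocks (c :: L) b) (hc : c.form.Isometric (-c.form))
    (hL : ∀ {D : Type u} [AddCommGroup D] [Finite D] {b : FiniteBilinearForm D},
      HasBlocks L b → b.Isometric (-b)) : b.Isometric (-b) := by
  obtain ⟨A, _, _, a, ha, hb⟩ := hb
  exact hb.antiIsometric (antiIsometric_prod hc (hL ha))

theorem HasBlocks.antiIsometric_cons_cons {c d : CyclicBlock} {L : List CyclicBlock}
    {b : FiniteBilinearForm D} (hb : HasBlocks (c :: d :: L) b)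
    (hc : (c.form.prod d.form).Isometric (-(c.form.prod d.form)))
    (hL : ∀ {D : Type u} [AddCommGroup D] [Finite D] {b : FiniteBilinearForm D},
      HasBlocks L b → b.Isometric (-b)) : b.Isometric (-b) := by
  obtain ⟨A, _, _, a, ⟨B, _, _, b', hb', ha⟩, hb⟩ := hb
  exact (hb.trans (((Isometric.refl _).prod ha).trans (prod_assoc _ _ _).symm)).antiIsometric
    (antiIsometric_prod hc (hL hb'))

end

end FiniteBilinearForm

/-! ### Persistence of the oddity condition under changes of the list -/

namespace CyclicBlock

theorem OddityCondition.tail {c : CyclicBlock} {L : List CyclicBlock}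
    (h : OddityCondition (c :: L)) (hc : c.p ≠ 2) : OddityCondition L := fun j hj hj' => by
  have := h j hj fun d hd hd2 => by
    rcases List.mem_cons.1 hd with rfl | hd
    · exact absurd hd2 hc
    · exact hj' d hd hd2
  rwa [totalOddity_cons, oddity_of_ne hc, zero_add] at this

/-- In levels below `d.k` the removed blocks contribute `c.a + d.a`, a multiple of `4` (and for `d.k
= 1` there is no such level to check). From level `d.k` on, the remaining blocks contribute nothing.
-/
theorem OddityCondition.tail_tail {c d : CyclicBlock} {L : List CyclicBlock}
    (h : OddityCondition (c :: d :: L)) (hc : c.p = 2) (hd : d.p = 2) (hdc : d.k ≤ c.k)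
    (hL : ∀ e ∈ L, e.k ≤ d.k) (hcd : (4 : ℤ) ∣ c.a + d.a ∨ d.k = 1) : OddityCondition L := by
  intro j hj hj'
  rcases Nat.lt_or_ge j d.k with h1 | h1
  · have h4 := hcd.resolve_right (by omega)
    have := h j hj fun e he he2 => by
      rcases List.mem_cons.1 he with rfl | he
      · omega
      · rcases List.mem_cons.1 he with rfl | he
        · omega
        · exact hj' e he he2
    rw [totalOddity_cons, totalOddity_cons, oddity_of_lt hc (h1.trans_le hdc),
      oddity_of_lt hd h1] at this
    omega
  · rw [totalOddity_of_le fun e he => (hL e he).trans h1]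
    exact dvd_zero _

theorem OddityCondition.replace {c d c' d' : CyclicBlock} {L : List CyclicBlock}
    (h : OddityCondition (c :: d :: L)) (hc : c.p = 2) (hd : d.p = 2) (hc' : c'.p = 2)
    (hd' : d'.p = 2) (hcc : c'.k = c.k) (hdd : d'.k = d.k) (hcd : d.k = c.k + 1)
    (ha : (4 : ℤ) ∣ c'.a + d'.a - (c.a + d.a)) : OddityCondition (c' :: d' :: L) := by
  intro j hj hj'
  have hcj : c.k ≠ j := hcc ▸ hj' c' (by simp) hc'
  have hdj : d.k ≠ j := hdd ▸ hj' d' (by simp) hd'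
  have := h j hj fun e he he2 => by
    rcases List.mem_cons.1 he with rfl | he
    · exact hcj
    · rcases List.mem_cons.1 he with rfl | he
      · exact hdj
      · exact hj' e (by simp [he]) he2
  rw [totalOddity_cons, totalOddity_cons] at this ⊢
  rcases Nat.lt_or_ge j c.k with h1 | h1
  · rw [oddity_of_lt hc h1, oddity_of_lt hd (by omega)] at this
    rw [oddity_of_lt hc' (by omega), oddity_of_lt hd' (by omega)]
    omega
  · rw [oddity_of_le h1, oddity_of_le (c := d) (by omega)] at this
    rw [oddity_of_le (by omega), oddity_of_le (c := d') (by omega)]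
    omega

theorem OddityCondition.sum {c d e s : CyclicBlock} {L : List CyclicBlock}
    (h : OddityCondition (c :: d :: e :: L)) (hc : c.p = 2) (hd : d.p = 2) (he : e.p = 2)
    (hs : s.p = 2) (hdk : d.k = c.k) (hek : e.k = c.k) (hsk : s.k = c.k)
    (ha : s.a = c.a + d.a + e.a) : OddityCondition (s :: L) := by
  intro j hj hj'
  have hsj : s.k ≠ j := hj' s (by simp) hs
  have := h j hj fun f hf hf2 => by
    simp only [List.mem_cons] at hf
    rcases hf with rfl | rfl | rfl | hf
    · omega
    · omega
    · omega
    · exact hj' f (by simp [hf]) hf2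
  simp only [totalOddity_cons] at this ⊢
  rcases Nat.lt_or_ge j c.k with h1 | h1
  · rw [oddity_of_lt hc h1, oddity_of_lt hd (by omega), oddity_of_lt he (by omega)] at this
    rw [oddity_of_lt hs (by omega)]
    omega
  · rw [oddity_of_le h1, oddity_of_le (c := d) (by omega), oddity_of_le (c := e) (by omega)] at this
    rw [oddity_of_le (by omega)]
    omega

end CyclicBlock

/-! ### The induction on the number of blocks -/

namespace FiniteBilinearForm

open CyclicBlock

universe u

/-- The case of blocks of `2`-power order. -/
theorem HasBlocks.antiIsometric_of_two (n : ℕ) : ∀ (L : List CyclicBlock), L.length = n →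
    (∀ c ∈ L, c.p = 2) → OddityCondition L →
    ∀ {D : Type u} [AddCommGroup D] [Finite D] {b : FiniteBilinearForm D},
      HasBlocks L b → b.Isometric (-b) := by
  induction n using Nat.strong_induction_on with | _ n ih =>
  intro L hn h2 ho D _ _ b hb
  by_cases hL : L = []
  · subst hL; exact hb.2.2
  obtain ⟨c, L₁, hp₁, hmax₁⟩ := exists_perm_max L hL
  have hc2 : c.p = 2 := h2 c (hp₁.mem_iff.2 (by simp))
  have hn₁ := hp₁.length_eq
  have hL₁ : ∀ e ∈ L₁, e.p = 2 := fun e he => h2 e (hp₁.mem_iff.2 (by simp [he]))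
  have hb₁ := hb.perm hp₁
  have ho₁ := ho.perm hp₁
  rw [List.length_cons] at hn₁
  have hca := not_two_dvd hc2
  have hck := c.k_ne_zero
  -- If the highest level is `1`, every total oddity in positive levels is an empty sum, so the
  -- condition for the tail is automatic.
  by_cases hc1 : c.k = 1
  · refine hb₁.antiIsometric_cons (form_antiIsometric_of_level_one c hc2 hc1) fun hb' =>
      ih _ (by omega) L₁ rfl hL₁ (fun j hj _ => ?_) hb'
    rw [totalOddity_of_le fun e he => (hmax₁ e he).trans (by omega)]
    exact dvd_zero _
  -- Otherwise level `c.k - 1` contains no block and its total oddity is the odd number `c.a`.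
  have hgap₁ : ∃ e ∈ L₁, c.k - 1 ≤ e.k := by
    by_contra! hlt
    have := ho₁ (c.k - 1) (by omega) fun e he _ => by
      rcases List.mem_cons.1 he with rfl | he
      · omega
      · exact (hlt e he).ne
    rw [totalOddity_cons, oddity_of_lt hc2 (by omega),
      totalOddity_of_le fun e he => (hlt e he).le] at this
    omega
  obtain ⟨e₁, he₁, hek₁⟩ := hgap₁
  obtain ⟨d, L₂, hp₂, hmax₂⟩ := exists_perm_max L₁ (List.ne_nil_of_mem he₁)
  have hd2 : d.p = 2 := hL₁ d (hp₂.mem_iff.2 (by simp))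
  have hn₂ := hp₂.length_eq
  have hL₂ : ∀ e ∈ L₂, e.p = 2 := fun e he => hL₁ e (hp₂.mem_iff.2 (by simp [he]))
  have hb₂ := hb₁.perm (hp₂.cons c)
  have ho₂ := ho₁.perm (hp₂.cons c)
  rw [List.length_cons] at hn₂
  have hda := not_two_dvd hd2
  have hdc : d.k ≤ c.k := hmax₁ d (hp₂.mem_iff.2 (by simp))
  have hdk : c.k - 1 ≤ d.k := by
    rcases List.mem_cons.1 (hp₂.mem_iff.1 he₁) with rfl | he
    · exact hek₁
    · exact hek₁.trans (hmax₂ e₁ he)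
  /- The pair of `c'` and `d'` splits off. -/
  have hpair : ∀ (c' d' : CyclicBlock) (L' : List CyclicBlock), L'.length < n →
      c'.p = 2 → d'.p = 2 → (∀ e ∈ L', e.p = 2) → (∀ e ∈ L', e.k ≤ d'.k) →
      (c'.k = d'.k ∨ c'.k = d'.k + 1) → ((4 : ℤ) ∣ c'.a + d'.a ∨ d'.k = 1) →
      OddityCondition (c' :: d' :: L') → HasBlocks (c' :: d' :: L') b → b.Isometric (-b) := by
    intro c' d' L' hl hc' hd' hL' hm hk h4 hoc hb'
    refine (hb'.perm (List.Perm.swap _ _ _)).antiIsometric_cons_cons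
      (form_prod_antiIsometric_of_two d' c' hd' hc' hk (by rwa [add_comm])) fun hb'' =>
      ih _ hl L' rfl hL' (hoc.tail_tail hc' hd' (by omega) hm h4) hb''
  by_cases h4 : (4 : ℤ) ∣ c.a + d.a ∨ d.k = 1
  · exact hpair c d L₂ (by omega) hc2 hd2 hL₂ hmax₂ (by omega) h4 ho₂ hb₂
  push Not at h4
  obtain ⟨h4, hd1⟩ := h4
  have hdk0 := d.k_ne_zero
  -- Otherwise level `d.k - 1` contains no block and its total oddity is `c.a + d.a`, which is not
  -- divisible by `4`.
  have hgap₂ : ∃ e ∈ L₂, d.k - 1 ≤ e.k := by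
    by_contra! hlt
    have := ho₂ (d.k - 1) (by omega) fun e he _ => by
      rcases List.mem_cons.1 he with rfl | he
      · omega
      · rcases List.mem_cons.1 he with rfl | he
        · omega
        · exact (hlt e he).ne
    rw [totalOddity_cons, totalOddity_cons, oddity_of_lt hc2 (by omega),
      oddity_of_lt hd2 (by omega), totalOddity_of_le fun e he => (hlt e he).le] at this
    omega
  obtain ⟨e₂, he₂, hek₂⟩ := hgap₂
  obtain ⟨e, L₃, hp₃, hmax₃⟩ := exists_perm_max L₂ (List.ne_nil_of_mem he₂)
  have he2 : e.p = 2 := hL₂ e (hp₃.mem_iff.2 (by simp))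
  have hn₃ := hp₃.length_eq
  have hL₃ : ∀ f ∈ L₃, f.p = 2 := fun f hf => hL₂ f (hp₃.mem_iff.2 (by simp [hf]))
  have hb₃ := hb₂.perm ((hp₃.cons d).cons c)
  have ho₃ := ho₂.perm ((hp₃.cons d).cons c)
  rw [List.length_cons] at hn₃
  have hea := not_two_dvd he2
  have hed : e.k ≤ d.k := hmax₂ e (hp₃.mem_iff.2 (by simp))
  have hek : d.k - 1 ≤ e.k := by
    rcases List.mem_cons.1 (hp₃.mem_iff.1 he₂) with rfl | he
    · exact hek₂
    · exact hek₂.trans (hmax₃ e₂ he)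
  -- From here on `c.a + d.a ≡ 2` mod `4`, so shifting either numerator by `2` would make the pair
  -- anti-isometric.
  by_cases hed' : e.k = d.k
  · by_cases hdc' : d.k = c.k
    · by_cases hce : (4 : ℤ) ∣ c.a + e.a
      · have hswap : (c :: d :: e :: L₃).Perm (c :: e :: d :: L₃) :=
          (List.Perm.swap _ _ _).cons c
        refine hpair c e (d :: L₃) (by simp; omega) hc2 he2 (by simpa [hd2] using hL₃) ?_
          (by omega) (Or.inl hce) (ho₃.perm hswap) (hb₃.perm hswap)
        intro f hf
        rcases List.mem_cons.1 hf with rfl | hf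
        · exact hed'.ge
        · exact hmax₃ f hf
      -- Three blocks in one level, neither tested pair summing to `0` mod `4`: merging them
      -- shortens the list by two and preserves the total oddities.
      · obtain ⟨s, hs2, hsk, hsa, hbs⟩ := hb₃.exists_sum hc2 hd2 he2 hdc' (hed'.trans hdc')
        exact ih (s :: L₃).length (by simp; omega) _ rfl (by simpa [hs2] using hL₃)
          (ho₃.sum hc2 hd2 he2 hs2 hdc' (hed'.trans hdc') hsk hsa) hbs
    · have hperm : (c :: d :: e :: L₃).Perm (e :: c :: d :: L₃) :=
        ((List.Perm.swap e d L₃).cons c).trans (List.Perm.swap e c _)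
      -- Here `d` and `e` lie one level below `c`. Doubling `e` and `c` shifts `c.a` by `2`, so that
      -- `c'` pairs with `d`.
      obtain ⟨e', c', he'2, hc'2, he'k, hc'k, he'a, hc'a, hiso⟩ :=
        exists_double e c he2 hc2 (by omega)
      have hperm' : (e' :: c' :: d :: L₃).Perm (c' :: d :: e' :: L₃) :=
        (List.Perm.swap c' e' _).trans ((List.Perm.swap d e' L₃).cons c')
      refine hpair c' d (e' :: L₃) (by simp; omega) hc'2 hd2 (by simpa [he'2] using hL₃) ?_
        (by omega) (Or.inl (by omega))
        (((ho₃.perm hperm).replace he2 hc2 he'2 hc'2 he'k hc'k (by omega) (by omega)).perm hperm')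
        (((hb₃.perm hperm).replace hiso).perm hperm')
      intro f hf
      rcases List.mem_cons.1 hf with rfl | hf
      · omega
      · exact (hmax₃ f hf).trans hed
  · have hperm : (c :: d :: e :: L₃).Perm (e :: d :: c :: L₃) :=
      (((List.Perm.swap e d L₃).cons c).trans (List.Perm.swap e c _)).trans
        ((List.Perm.swap d c L₃).cons e)
    -- Here `e` lies one level below `d`. Doubling `e` and `d` shifts `d.a` by `2`, so that `c`
    -- pairs with `d'`.
    obtain ⟨e', d', he'2, hd'2, he'k, hd'k, he'a, hd'a, hiso⟩ :=
      exists_double e d he2 hd2 (by omega)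
    have hperm' : (e' :: d' :: c :: L₃).Perm (c :: d' :: e' :: L₃) :=
      ((List.Perm.swap c d' L₃).cons e').trans
        ((List.Perm.swap c e' _).trans ((List.Perm.swap d' e' L₃).cons c))
    refine hpair c d' (e' :: L₃) (by simp; omega) hc2 hd'2 (by simpa [he'2] using hL₃) ?_
      (by omega) (Or.inl (by omega))
      (((ho₃.perm hperm).replace he2 hd2 he'2 hd'2 he'k hd'k (by omega) (by omega)).perm hperm')
      (((hb₃.perm hperm).replace hiso).perm hperm')
    intro f hf
    rcases List.mem_cons.1 hf with rfl | hf
    · omega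
    · exact (hmax₃ f hf).trans (by omega)

/-- Blocks at odd primes are removed first: singly if `p ≡ 1` mod `4`, and in pairs of equal order
if `p ≡ 3`, where the parity condition supplies the partner. -/
theorem HasBlocks.antiIsometric (n : ℕ) : ∀ (L : List CyclicBlock), L.length = n →
    ParityCondition L → OddityCondition L →
    ∀ {D : Type u} [AddCommGroup D] [Finite D] {b : FiniteBilinearForm D},
      HasBlocks L b → b.Isometric (-b) := by
  induction n using Nat.strong_induction_on with | _ n ih =>
  intro L hn hpar ho D _ _ b hb
  by_cases h2 : ∀ c ∈ L, c.p = 2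
  · exact HasBlocks.antiIsometric_of_two n L hn h2 ho hb
  push Not at h2
  obtain ⟨c, hcL, hc⟩ := h2
  obtain ⟨L₁, hp₁⟩ : ∃ L₁, L.Perm (c :: L₁) := by
    classical
    exact ⟨_, List.perm_cons_erase hcL⟩
  have hn₁ := hp₁.length_eq
  rw [List.length_cons] at hn₁
  have hodd := c.prime.eq_two_or_odd.resolve_left hc
  by_cases hc1 : c.p % 4 = 1
  · refine (hb.perm hp₁).antiIsometric_cons (form_antiIsometric_of_one_mod_four c hc1) fun hb' =>
      ih _ (by omega) L₁ rfl (fun p k hp => ?_) ((ho.perm hp₁).tail hc) hb'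
    have := hpar.perm hp₁ p k hp
    rwa [blockRank_cons, if_neg (by rintro ⟨rfl, -⟩; omega)] at this
  · have hc3 : c.p % 4 = 3 := by omega
    have heven := hpar.perm hp₁ c.p c.k hc3
    rw [blockRank_cons, if_pos ⟨rfl, rfl⟩] at heven
    have hpos : 0 < blockRank L₁ c.p c.k := by
      rcases Nat.eq_zero_or_pos (blockRank L₁ c.p c.k) with h0 | h0
      · rw [h0] at heven; exact absurd heven (by decide)
      · exact h0
    obtain ⟨d, hdL, hd⟩ := List.countP_pos_iff.1 hpos
    obtain ⟨hdp, hdk⟩ := of_decide_eq_true hd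
    obtain ⟨L₂, hp₂⟩ : ∃ L₂, L₁.Perm (d :: L₂) := by
      classical
      exact ⟨_, List.perm_cons_erase hdL⟩
    have hn₂ := hp₂.length_eq
    rw [List.length_cons] at hn₂
    have hperm := hp₁.trans (hp₂.cons c)
    refine (hb.perm hperm).antiIsometric_cons_cons
      (form_prod_antiIsometric_of_odd c d hc hdp.symm hdk.symm) fun hb' =>
      ih _ (by omega) L₂ rfl (fun p k hp => ?_)
        (((ho.perm hperm).tail hc).tail (hdp ▸ hc)) hb'
    have := hpar.perm hperm p k hp
    rw [blockRank_cons, blockRank_cons, hdp, hdk] at this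
    split_ifs at this
    · simpa [add_assoc, Nat.even_add] using this
    · simpa using this

end FiniteBilinearForm

/-! ### Odd primes: homogeneous ranks and discriminants -/

namespace FiniteBilinearForm

open CyclicBlock

universe u

theorem eq_zero_of_coprime_nsmul {A : Type*} [AddCommGroup A] {m n : ℕ} (h : Nat.Coprime m n)
    {x : A} (hm : m • x = 0) (hn : n • x = 0) : x = 0 := by
  rw [← addOrderOf_dvd_iff_nsmul_eq_zero] at hm hn
  exact AddMonoid.addOrderOf_eq_one_iff.1 (Nat.eq_one_of_dvd_coprimes h hm hn)

theorem card_torsion_prod (A B : Type*) [AddCommGroup A] [AddCommGroup B] (n : ℕ) :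
    Nat.card {x : A × B // n • x = 0} =
      Nat.card {x : A // n • x = 0} * Nat.card {x : B // n • x = 0} := by
  rw [← Nat.card_prod]
  exact Nat.card_congr ((Equiv.subtypeEquivRight fun x => by
    rw [Prod.ext_iff]; rfl).trans (Equiv.subtypeProdEquivProd (p := fun x : A => n • x = 0)
      (q := fun x : B => n • x = 0)))

theorem card_torsion_congr {A B : Type*} [AddCommGroup A] [AddCommGroup B] (f : A ≃+ B) (n : ℕ) :
    Nat.card {x : A // n • x = 0} = Nat.card {x : B // n • x = 0} :=
  Nat.card_congr (f.toEquiv.subtypeEquiv fun x => by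
    rw [← map_eq_zero_iff f f.injective, map_nsmul]; rfl)

theorem card_torsion_eq_one {A : Type*} [AddCommGroup A] {m n : ℕ} (h : Nat.Coprime m n)
    (hm : ∀ x : A, m • x = 0) : Nat.card {x : A // n • x = 0} = 1 := by
  have : Subsingleton {x : A // n • x = 0} := ⟨fun x y => Subtype.ext <| by
    rw [eq_zero_of_coprime_nsmul h (hm x) x.2, eq_zero_of_coprime_nsmul h (hm y) y.2]⟩
  have : Nonempty {x : A // n • x = 0} := ⟨⟨0, smul_zero n⟩⟩
  exact Nat.card_unique

theorem card_torsion_zmod_prime_pow (p : ℕ) [hp : Fact p.Prime] (k n : ℕ) :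
    Nat.card {x : ZMod (p ^ k) // p ^ n • x = 0} = p ^ min k n := by
  have h := IsAddCyclic.card_nsmulAddMonoidHom_ker (G := ZMod (p ^ k)) (p ^ n)
  rw [Nat.card_zmod] at h
  have h2 : (p ^ k).gcd (p ^ n) = p ^ min k n := by
    rcases le_total k n with hkn | hkn
    · rw [min_eq_left hkn, Nat.gcd_eq_left (pow_dvd_pow p hkn)]
    · rw [min_eq_right hkn, Nat.gcd_eq_right (pow_dvd_pow p hkn)]
  rw [← h2, ← h]
  rfl

theorem HasBlocks.card_torsion (p : ℕ) [hp : Fact p.Prime] (hp2 : p ≠ 2) (n : ℕ) :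
    ∀ {L : List CyclicBlock} {D : Type u} [AddCommGroup D] [Finite D] {b : FiniteBilinearForm D},
      HasBlocks L b → Nat.card {x : D // p ^ n • x = 0} =
        p ^ (L.map fun c => if c.p = p then min c.k n else 0).sum
  | [], _, _, _, _, ⟨⟨M, hM⟩, _⟩ => by
    rw [card_torsion_eq_one (((Nat.coprime_primes Nat.prime_two hp.out).2 hp2.symm).pow M n) hM]
    simp
  | c :: L, _, _, _, _, ⟨A, _, _, a, ha, f, _⟩ => by
    rw [card_torsion_congr f, card_torsion_prod, ha.card_torsion p hp2 n, List.map_cons,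
      List.sum_cons, pow_add]
    congr 1
    split_ifs with h
    · obtain ⟨q, k, x, hq, hk, hx⟩ := c
      simp only at h
      subst h
      exact card_torsion_zmod_prime_pow _ _ _
    · exact card_torsion_eq_one (((Nat.coprime_primes c.prime hp.out).2 h).pow c.k n)
        fun x => ZModModule.char_nsmul_eq_zero _ x

/-- Counting `p^n`-torsion in both decompositions gives equal sums of `min(k, n)` over the summands
for every `n`; the second difference in `n` isolates the summands of exponent `k`. -/
theorem HasBlocks.homogeneousRank_eq (p : ℕ) [hp : Fact p.Prime] (hp2 : p ≠ 2) (k : ℕ)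
    (hk : 1 ≤ k) {L : List CyclicBlock} {D : Type u} [AddCommGroup D] [Finite D]
    {b : FiniteBilinearForm D} (hb : HasBlocks L b) :
    homogeneousRank D p k = blockRank L p k := by
  obtain ⟨-, ⟨f⟩⟩ := (exists_homogeneous_decomposition D p).choose_spec
  rw [homogeneousRank]
  generalize (exists_homogeneous_decomposition D p).choose = d at f
  have hφ : ∀ n, (d.sum fun k m => m * min k n) =
      (L.map fun c => if c.p = p then min c.k n else 0).sum := fun n => by
    apply Nat.pow_right_injective hp.out.two_le
    change p ^ _ = p ^ _
    rw [← card_torsion_decomposition, ← hb.card_torsion p hp2, ← card_torsion_congr f]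
    exact Nat.card_congr
      { toFun := fun x => ⟨x.1.1, congrArg Subtype.val x.2⟩
        invFun := fun x => ⟨⟨x.1, ⟨n, x.2⟩⟩, Subtype.ext x.2⟩
        left_inv := fun _ => rfl
        right_inv := fun _ => rfl }
  have hmin : ∀ i, 2 * min i k = min i (k - 1) + min i (k + 1) + if i = k then 1 else 0 :=
    fun i => by split_ifs <;> omega
  have h1 : 2 * (d.sum fun i m => m * min i k) = (d.sum fun i m => m * min i (k - 1)) +
      (d.sum fun i m => m * min i (k + 1)) + d k := by
    simp only [Finsupp.sum]
    have h : d k = ∑ i ∈ d.support, if i = k then d i else 0 := by simp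
    rw [h, Finset.mul_sum, ← Finset.sum_add_distrib, ← Finset.sum_add_distrib]
    refine Finset.sum_congr rfl fun i _ => ?_
    calc 2 * (d i * min i k) = d i * (2 * min i k) := by ring
      _ = _ := by rw [hmin]; split_ifs <;> ring
  have h2 : 2 * (L.map fun c => if c.p = p then min c.k k else 0).sum =
      (L.map fun c => if c.p = p then min c.k (k - 1) else 0).sum +
      (L.map fun c => if c.p = p then min c.k (k + 1) else 0).sum + blockRank L p k := by
    clear hb hφ
    induction L with
    | nil => rfl
    | cons c L ih =>
      simp only [List.map_cons, List.sum_cons, blockRank_cons, mul_add, ih]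
      by_cases h : c.p = p
      · have := hmin c.k
        simp only [h, if_true, true_and]
        omega
      · simp only [h, false_and, if_false]
        omega
  rw [hφ, hφ, hφ] at h1
  omega

theorem nsmul_zmodFrac_prime_pow (p k : ℕ) [Fact p.Prime] (hk : k ≠ 0) (x : ZMod (p ^ k)) :
    p ^ (k - 1) • zmodFrac (p ^ k) x =
      zmodFrac p (ZMod.castHom (dvd_pow_self p hk) (ZMod p) x) := by
  obtain ⟨m, rfl⟩ := ZMod.intCast_surjective x
  rw [map_intCast (ZMod.castHom (dvd_pow_self p hk) (ZMod p)), zmodFrac_intCast, zmodFrac_intCast]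
  have hp : (p : ℚ) ≠ 0 := Nat.cast_ne_zero.2 (NeZero.ne p)
  obtain ⟨k, rfl⟩ := Nat.exists_eq_succ_of_ne_zero hk
  rw [Nat.succ_eq_add_one, Nat.add_sub_cancel]
  change ((p ^ k • (m / (p ^ (k + 1) : ℕ) : ℚ) : ℚ) : AddCircle (1 : ℚ)) = _
  congr 1
  rw [nsmul_eq_mul]
  push_cast
  field_simp
  ring

/-- Blocks of a different order do not contribute to the form of level `k`. -/
theorem form_nsmul_toHom_eq_zero (c : CyclicBlock) (p k : ℕ) [hp : Fact p.Prime] (hk : k ≠ 0)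
    (h : ¬ (c.p = p ∧ c.k = k)) (x y : ZMod (c.p ^ c.k)) (hx : p ^ k • x = 0)
    (hy : p ^ k • y = 0) : p ^ (k - 1) • c.form.toHom x y = 0 := by
  obtain ⟨q, l, a, hq, hl, ha⟩ := c
  simp only at h x y hx hy ⊢
  by_cases hqp : q = p
  · subst hqp
    rw [form_toHom, nsmul_zmodFrac]
    simp only
    convert map_zero (zmodFrac (q ^ l)) using 2
    obtain ⟨x, rfl⟩ := ZMod.intCast_surjective x
    obtain ⟨y, rfl⟩ := ZMod.intCast_surjective y
    rw [nsmul_eq_mul, ← Int.cast_natCast, ← Int.cast_mul, ZMod.intCast_zmod_eq_zero_iff_dvd]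
      at hx hy
    rw [← Int.cast_natCast, ← Int.cast_mul, ← Int.cast_mul, ← Int.cast_mul,
      ZMod.intCast_zmod_eq_zero_iff_dvd]
    push_cast at hx hy ⊢
    rcases lt_or_gt_of_ne (fun hlk => h ⟨rfl, hlk⟩ : l ≠ k) with hlk | hlk
    · exact (pow_dvd_pow _ (by omega)).mul_right _
    · obtain ⟨m, rfl⟩ := Nat.exists_eq_add_of_lt hlk
      have hq0 : (q : ℤ) ^ k ≠ 0 := pow_ne_zero _ (by exact_mod_cast hq.ne_zero)
      have hdiv : ∀ z : ℤ, (q : ℤ) ^ (k + m + 1) ∣ q ^ k * z → (q : ℤ) ^ (m + 1) ∣ z := fun z hz => by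
        rw [add_assoc, pow_add] at hz
        exact (mul_dvd_mul_iff_left hq0).1 hz
      obtain ⟨u, rfl⟩ := hdiv x hx
      obtain ⟨v, rfl⟩ := hdiv y hy
      obtain ⟨k, rfl⟩ := Nat.exists_eq_succ_of_ne_zero hk
      rw [Nat.succ_eq_add_one, Nat.add_sub_cancel]
      exact ⟨q ^ m * a * u * v, by ring⟩
  · have h0 : x = 0 := eq_zero_of_coprime_nsmul
      (((Nat.coprime_primes hq hp.out).2 hqp).pow l k) (ZModModule.char_nsmul_eq_zero _ x) hx
    rw [h0, map_zero, AddMonoidHom.zero_apply, smul_zero]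

/-- Coordinates diagonalizing the form `p^(k-1) b` on the `p^k`-torsion. -/
theorem HasBlocks.exists_coordinates (p k : ℕ) [hp : Fact p.Prime] (hp2 : p ≠ 2) (hk : k ≠ 0) :
    ∀ {L : List CyclicBlock} {D : Type u} [AddCommGroup D] [Finite D] {b : FiniteBilinearForm D},
      HasBlocks L b → ∃ (I : Type) (_ : Fintype I) (_ : DecidableEq I) (γ : I → ZMod p)
        (m : D → I → ZMod p) (e : I → D), Fintype.card I = blockRank L p k ∧ (∀ i, γ i ≠ 0) ∧
        m 0 = 0 ∧ (∀ i, p ^ k • e i = 0) ∧ (∀ i, m (e i) = Pi.single i 1) ∧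
        ∀ x y, p ^ k • x = 0 → p ^ k • y = 0 →
          p ^ (k - 1) • b.toHom x y = zmodFrac p (∑ i, γ i * m x i * m y i)
  | [], _, _, _, _, ⟨⟨M, hM⟩, _⟩ => by
    refine ⟨Empty, inferInstance, inferInstance, Empty.elim, fun _ => Empty.elim, Empty.elim,
      by simp [blockRank], fun i => i.elim, funext fun i => i.elim, fun i => i.elim, fun i => i.elim,
      fun x y hx hy => ?_⟩
    have h0 : x = 0 := eq_zero_of_coprime_nsmul
      (((Nat.coprime_primes Nat.prime_two hp.out).2 hp2.symm).pow M k) (hM x) hx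
    simp [h0]
  | c :: L, D, _, _, b, ⟨A, _, _, a, ha, f, hf⟩ => by
    obtain ⟨I, _, _, γ, m, e, hI, hγ, hm0, he, hm, hab⟩ := ha.exists_coordinates p k hp2 hk
    have hfx : ∀ x, p ^ k • x = 0 → p ^ k • (f x).1 = 0 ∧ p ^ k • (f x).2 = 0 := fun x hx => by
      have : p ^ k • f x = 0 := by rw [← map_nsmul, hx, map_zero]
      exact ⟨congrArg Prod.fst this, congrArg Prod.snd this⟩
    by_cases h : c.p = p ∧ c.k = k
    · obtain ⟨q, l, r, hq, hl, hr⟩ := c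
      simp only at h
      obtain ⟨rfl, rfl⟩ := h
      refine ⟨Option I, inferInstance, inferInstance, fun i => i.elim (r : ZMod q) γ,
        fun x i => i.elim (ZMod.castHom (dvd_pow_self q hk) (ZMod q) (f x).1) (m (f x).2),
        fun i => f.symm (i.elim ((1 : ZMod (q ^ l)), 0) fun i => (0, e i)), ?_, ?_, ?_, ?_, ?_, ?_⟩
      · rw [Fintype.card_option, hI, blockRank_cons, if_pos ⟨rfl, rfl⟩]
      · rintro (_ | i)
        · exact fun h => hr ((ZMod.intCast_zmod_eq_zero_iff_dvd r q).1 h)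
        · exact hγ i
      · funext i
        rcases i with _ | i <;> simp [hm0]
      · intro i
        rw [← map_nsmul]
        convert map_zero f.symm using 2
        rcases i with _ | i
        · exact Prod.ext (ZModModule.char_nsmul_eq_zero _ (1 : ZMod (q ^ l)))
            (by rw [Prod.smul_snd]; exact smul_zero _)
        · exact Prod.ext (by rw [Prod.smul_fst]; exact smul_zero _) (he i)
      · rintro (_ | i) <;> funext j
        · rcases j with _ | j
          · simp [-ZMod.castHom_apply]
          · simp [hm0]
        · rcases j with _ | j
          · simp
          · simp [hm, Pi.single_apply]
      · intro x y hx hy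
        rw [hf, prod_toHom, smul_add, hab _ _ (hfx x hx).2 (hfx y hy).2, form_toHom,
          nsmul_zmodFrac_prime_pow _ _ hk, ← map_add, Fintype.sum_option]
        simp [-ZMod.castHom_apply]
    · refine ⟨I, inferInstance, inferInstance, γ, fun x => m (f x).2, fun i => f.symm (0, e i),
        ?_, hγ, by simp [hm0], fun i => ?_, fun i => ?_, fun x y hx hy => ?_⟩
      · rw [hI, blockRank_cons, if_neg h, add_zero]
      · rw [← map_nsmul]
        convert map_zero f.symm using 2
        exact Prod.ext (by rw [Prod.smul_fst]; exact smul_zero _) (he i)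
      · simp [hm]
      · rw [hf, prod_toHom, smul_add, hab _ _ (hfx x hx).2 (hfx y hy).2,
          form_nsmul_toHom_eq_zero c p k hk h _ _ (hfx x hx).1 (hfx y hy).1, zero_add]

/-- In the diagonalizing coordinates mod `p`, the anti-isometry has a matrix `M` with `Mᵀ Γ M = -Γ`.
Hence `det M ² = (-1)^n` with `n` the number of blocks, and for odd `n` this would make `-1` a
square mod `p ≡ 3` mod `4`. -/
theorem HasBlocks.even_blockRank (p k : ℕ) [hp : Fact p.Prime] (hp4 : p % 4 = 3) (hk : k ≠ 0)
    {L : List CyclicBlock} {D : Type u} [AddCommGroup D] [Finite D] {b : FiniteBilinearForm D}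
    (hb : HasBlocks L b) (h : b.Isometric (-b)) : Even (blockRank L p k) := by
  obtain ⟨I, _, _, γ, m, e, hI, hγ, -, he, hm, hab⟩ :=
    hb.exists_coordinates p k (by omega) hk
  obtain ⟨f, hf⟩ := h
  let M : Matrix I I (ZMod p) := Matrix.of fun i j => m (f (e j)) i
  have hM : M.transpose * Matrix.diagonal γ * M = -Matrix.diagonal γ := by
    ext i j
    have hfe : ∀ i, p ^ k • f (e i) = 0 := fun i => by rw [← map_nsmul, he, map_zero]
    have h1 := hab _ _ (hfe i) (hfe j)
    have h2 := hab _ _ (he i) (he j)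
    rw [hf, neg_toHom, smul_neg, h1, ← map_neg] at h2
    have h3 := zmodFrac_injective p h2
    rw [Matrix.mul_apply, Matrix.neg_apply, Matrix.diagonal_apply]
    have h4 : ∑ x, (M.transpose * Matrix.diagonal γ) i x * M x j =
        ∑ x, γ x * m (f (e i)) x * m (f (e j)) x :=
      Finset.sum_congr rfl fun x _ => by
        rw [Matrix.mul_diagonal, Matrix.transpose_apply]
        simp only [M, Matrix.of_apply]
        ring
    rw [h4, ← neg_eq_iff_eq_neg, h3]
    simp only [hm, Pi.single_apply]
    by_cases hij : i = j
    · subst hij; simp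
    · simp [hij, Ne.symm hij]
  have hdet := congrArg Matrix.det hM
  rw [Matrix.det_mul, Matrix.det_mul, Matrix.det_transpose, Matrix.det_neg,
    Matrix.det_diagonal] at hdet
  have hprod : ∏ i, γ i ≠ 0 := Finset.prod_ne_zero_iff.2 fun i _ => hγ i
  by_contra hodd
  rw [Nat.not_even_iff_odd, ← hI] at hodd
  rw [hodd.neg_one_pow] at hdet
  have hsq : M.det * M.det = -1 := mul_right_cancel₀ hprod (by rw [← hdet]; ring)
  exact ZMod.exists_sq_eq_neg_one_iff.1 ⟨M.det, hsq.symm⟩ hp4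

end FiniteBilinearForm

/-! ### Gauss sums of level `j` -/

theorem expQZ_ratCast_int (n : ℤ) : expQZ (((n : ℚ)) : AddCircle (1 : ℚ)) = 1 := by
  rw [(ratCircle_eq_zero_iff (n : ℚ)).2 ⟨n, rfl⟩, expQZ_zero]

theorem expQZ_ratCast_add (x y : ℚ) : expQZ ((x + y : ℚ) : AddCircle (1 : ℚ)) =
    expQZ (x : AddCircle (1 : ℚ)) * expQZ (y : AddCircle (1 : ℚ)) := by
  rw [← expQZ_add]; rfl

theorem expQZ_int_div_four (n : ℤ) :
    expQZ ((n / 4 : ℚ) : AddCircle (1 : ℚ)) = Complex.I ^ n := by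
  have h : Complex.I ^ n = Complex.exp (n * (Real.pi / 2 * Complex.I)) := by
    rw [Complex.exp_int_mul, Complex.exp_pi_div_two_mul_I]
  rw [expQZ_coe, h]
  congr 1
  push_cast
  ring

theorem expQZ_half : expQZ ((1 / 2 : ℚ) : AddCircle (1 : ℚ)) = -1 := by
  rw [expQZ_coe, ← Complex.exp_pi_mul_I]
  congr 1
  push_cast
  ring

theorem expQZ_odd_div_two {n : ℤ} (hn : ¬ (2 : ℤ) ∣ n) :
    expQZ ((n / 2 : ℚ) : AddCircle (1 : ℚ)) = -1 := by
  obtain ⟨s, hs⟩ : (2 : ℤ) ∣ n - 1 := by omega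
  obtain rfl : n = 2 * s + 1 := by linarith
  rw [show (((2 * s + 1 : ℤ) : ℚ) / 2 : ℚ) = (s : ℚ) + 1 / 2 by push_cast; ring,
    expQZ_ratCast_add, expQZ_ratCast_int, expQZ_half, one_mul]

theorem conj_expQZ_ratCast (x : ℚ) : starRingEnd ℂ (expQZ (x : AddCircle (1 : ℚ))) =
    expQZ ((-x : ℚ) : AddCircle (1 : ℚ)) := by
  rw [← expQZ_neg]; rfl

theorem sum_range_two_mul (f : ℕ → ℂ) (n : ℕ) :
    ∑ x ∈ Finset.range (2 * n), f x = ∑ x ∈ Finset.range n, (f (2 * x) + f (2 * x + 1)) := by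
  induction n with
  | zero => simp
  | succ n ih =>
    rw [Nat.mul_succ, Finset.sum_range_succ, Finset.sum_range_succ, ih, Finset.sum_range_succ]
    ring

theorem sum_range_two_pow_succ (f : ℕ → ℂ) (n : ℕ) :
    ∑ x ∈ Finset.range (2 ^ (n + 1)), f x =
      ∑ x ∈ Finset.range (2 ^ n), (f x + f (2 ^ n + x)) := by
  rw [pow_succ, mul_two, Finset.sum_range_add, Finset.sum_add_distrib]

/-- The `x`-th term of the Gauss sum of `a x² / 2^(m+1)`. -/
noncomputable def gaussTerm (a : ℤ) (m x : ℕ) : ℂ :=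
  expQZ ((a * x ^ 2 / 2 ^ (m + 1) : ℚ) : AddCircle (1 : ℚ))

theorem gaussTerm_add_two_pow (a : ℤ) (m n x : ℕ) (hm : m ≠ 0) (hmn : m ≤ n) :
    gaussTerm a m (2 ^ n + x) = gaussTerm a m x := by
  obtain ⟨r, rfl⟩ := Nat.exists_eq_add_of_le hmn
  obtain ⟨m, rfl⟩ := Nat.exists_eq_succ_of_ne_zero hm
  have : (a * ((2 ^ (m.succ + r) + x : ℕ) : ℚ) ^ 2 / 2 ^ (m.succ + 1) : ℚ) =
      ((a * (2 ^ (m + r + r) + 2 ^ r * x) : ℤ) : ℚ) + a * x ^ 2 / 2 ^ (m.succ + 1) := by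
    push_cast
    field_simp
    rw [Nat.succ_eq_add_one]
    ring
  rw [gaussTerm, this, expQZ_ratCast_add, expQZ_ratCast_int, one_mul, gaussTerm]

/-- Determines the line through `0` on which the sum lies. The sums for `m = 0` and `m = 1` are `1 +
i^a` and `2 exp(2πi a/8)`, and raising `m` by `2` only doubles the sum. -/
theorem conj_sum_gaussTerm_eq (a : ℤ) (ha : ¬ (2 : ℤ) ∣ a) (m : ℕ) :
    starRingEnd ℂ (∑ x ∈ Finset.range (2 ^ (m + 1)), gaussTerm a (m + 1) x) =
      Complex.I ^ (-a) * ∑ x ∈ Finset.range (2 ^ (m + 1)), gaussTerm a (m + 1) x := by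
  induction m using Nat.strong_induction_on with | _ m ih =>
  match m with
  | 0 =>
    have h1 : gaussTerm a 1 1 = Complex.I ^ a := by
      rw [← expQZ_int_div_four, gaussTerm]
      congr 2
      push_cast
      norm_num
    have h0 : gaussTerm a 1 0 = 1 := by
      rw [gaussTerm]
      convert expQZ_zero using 2
      simp
    have h2 : starRingEnd ℂ (Complex.I ^ a) = Complex.I ^ (-a) := by
      rw [map_zpow₀, Complex.conj_I, zpow_neg, ← inv_zpow, Complex.inv_I]
    simp only [zero_add, pow_one, Finset.sum_range_succ, Finset.sum_range_zero, h0, h1, map_add,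
      map_one, h2, mul_add, mul_one]
    rw [zpow_neg, inv_mul_cancel₀ (zpow_ne_zero _ Complex.I_ne_zero), add_comm]
  | 1 =>
    have h0 : gaussTerm a 2 0 = 1 := by
      rw [gaussTerm]
      convert expQZ_zero using 2
      simp
    have h2 : gaussTerm a 2 2 = -1 := by
      rw [gaussTerm, ← expQZ_odd_div_two ha]
      congr 2
      push_cast
      ring
    have h1 : gaussTerm a 2 1 = expQZ ((a / 8 : ℚ) : AddCircle (1 : ℚ)) := by
      rw [gaussTerm]
      congr 2
      push_cast
      ring
    have h3 : gaussTerm a 2 3 = expQZ ((a / 8 : ℚ) : AddCircle (1 : ℚ)) := by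
      rw [gaussTerm, show (a * ((3 : ℕ) : ℚ) ^ 2 / 2 ^ (2 + 1) : ℚ) = (a : ℚ) + a / 8 by
        push_cast; ring, expQZ_ratCast_add, expQZ_ratCast_int, one_mul]
    have h4 : starRingEnd ℂ (expQZ ((a / 8 : ℚ) : AddCircle (1 : ℚ))) =
        Complex.I ^ (-a) * expQZ ((a / 8 : ℚ) : AddCircle (1 : ℚ)) := by
      rw [conj_expQZ_ratCast, ← expQZ_int_div_four, ← expQZ_ratCast_add]
      congr 2
      push_cast
      ring
    have hs : ∑ x ∈ Finset.range (2 ^ (1 + 1)), gaussTerm a (1 + 1) x =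
        2 * expQZ ((a / 8 : ℚ) : AddCircle (1 : ℚ)) := by
      norm_num [Finset.sum_range_succ, h0, h1, h2, h3]
      ring
    rw [hs, map_mul, h4, map_ofNat]
    ring
  | m + 2 =>
    have hs : ∑ x ∈ Finset.range (2 ^ (m + 2 + 1)), gaussTerm a (m + 2 + 1) x =
        2 * ∑ x ∈ Finset.range (2 ^ (m + 1)), gaussTerm a (m + 1) x := by
      -- Compare `x` with its shift by half the range: for odd `x` the exponent changes by a
      -- half-integer and the two terms cancel, while the even terms `2x` occur twice and reproduce
      -- the shorter sum.
      rw [sum_range_two_pow_succ, pow_succ', sum_range_two_mul, Finset.mul_sum]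
      refine Finset.sum_congr rfl fun x _ => ?_
      have hev : gaussTerm a (m + 2 + 1) (2 * x) = gaussTerm a (m + 1) x := by
        rw [gaussTerm, gaussTerm]
        congr 2
        push_cast
        field_simp
        ring
      have hev' : gaussTerm a (m + 2 + 1) (2 * 2 ^ (m + 1) + 2 * x) = gaussTerm a (m + 1) x := by
        rw [← mul_add, ← gaussTerm_add_two_pow a (m + 1) (m + 1) x (by omega) le_rfl, gaussTerm,
          gaussTerm]
        congr 2
        push_cast
        field_simp
        ring
      have hod : gaussTerm a (m + 2 + 1) (2 * 2 ^ (m + 1) + (2 * x + 1)) =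
          -gaussTerm a (m + 2 + 1) (2 * x + 1) := by
        have hodd : ¬ (2 : ℤ) ∣ a * (2 * x + 1) := Int.prime_two.not_dvd_mul ha (by omega)
        rw [gaussTerm, show (a * ((2 * 2 ^ (m + 1) + (2 * x + 1) : ℕ) : ℚ) ^ 2 /
          2 ^ (m + 2 + 1 + 1) : ℚ) = (((a * 2 ^ m : ℤ) : ℚ) + ((a * (2 * x + 1) : ℤ) : ℚ) / 2) +
            a * ((2 * x + 1 : ℕ) : ℚ) ^ 2 / 2 ^ (m + 2 + 1 + 1) by
          push_cast
          field_simp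
          ring, expQZ_ratCast_add, expQZ_ratCast_add, expQZ_ratCast_int, expQZ_odd_div_two hodd,
          gaussTerm]
        ring
      rw [hev, hev', hod]
      ring
    rw [hs, map_mul, ih m (by omega), map_ofNat]
    ring

theorem sum_gaussTerm_two_pow_add (a : ℤ) (m n : ℕ) (hm : m ≠ 0) :
    ∑ x ∈ Finset.range (2 ^ (m + n)), gaussTerm a m x =
      2 ^ n * ∑ x ∈ Finset.range (2 ^ m), gaussTerm a m x := by
  induction n with
  | zero => simp
  | succ n ih =>
    rw [← add_assoc, sum_range_two_pow_succ]
    simp only [gaussTerm_add_two_pow a m (m + n) _ hm (Nat.le_add_right _ _), ← two_mul]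
    rw [← Finset.mul_sum, ih]
    ring

theorem sum_zmod_eq_sum_range (N : ℕ) [NeZero N] (f : ZMod N → ℂ) :
    ∑ x, f x = ∑ i ∈ Finset.range N, f i :=
  (Finset.sum_nbij' (fun i : ℕ => (i : ZMod N)) ZMod.val (fun _ _ => Finset.mem_univ _)
    (fun x _ => Finset.mem_range.2 (ZMod.val_lt x))
    (fun _ hi => ZMod.val_cast_of_lt (Finset.mem_range.1 hi))
    (fun x _ => ZMod.natCast_zmod_val x) fun _ _ => rfl).symm

/-! ### Gauss sums of forms and the signature invariants -/

namespace FiniteBilinearForm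

open CyclicBlock

universe u

open Classical in
/-- The Gauss sum of `2^j b(x, x)` over the `2`-primary component. -/
noncomputable def levelSum {D : Type*} [AddCommGroup D] [Finite D] (b : FiniteBilinearForm D)
    (j : ℕ) : ℂ :=
  ∑ᶠ x : D, if x ∈ AddCommGroup.primaryComponent D 2 then expQZ (2 ^ j • b.toHom x x) else 0

theorem mem_primaryComponent_iff {D : Type*} [AddCommGroup D] {p : ℕ} {x : D} :
    x ∈ AddCommGroup.primaryComponent D p ↔ ∃ n : ℕ, p ^ n • x = 0 := Iff.rfl

section

variable {A B : Type*} [AddCommGroup A] [Finite A] [AddCommGroup B] [Finite B]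

theorem levelSum_congr {a : FiniteBilinearForm A} {b : FiniteBilinearForm B}
    (h : a.Isometric b) (j : ℕ) : a.levelSum j = b.levelSum j := by
  obtain ⟨f, hf⟩ := h
  refine finsum_eq_of_bijective f f.bijective fun x => ?_
  have : x ∈ AddCommGroup.primaryComponent A 2 ↔ f x ∈ AddCommGroup.primaryComponent B 2 := by
    simp only [mem_primaryComponent_iff, ← map_nsmul, map_eq_zero_iff f f.injective]
  by_cases hx : x ∈ AddCommGroup.primaryComponent A 2
  · rw [if_pos hx, if_pos (this.1 hx), hf]
  · rw [if_neg hx, if_neg fun h => hx (this.2 h)]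

theorem levelSum_neg (a : FiniteBilinearForm A) (j : ℕ) :
    (-a).levelSum j = starRingEnd ℂ (a.levelSum j) := by
  have := Fintype.ofFinite A
  rw [levelSum, levelSum, finsum_eq_sum_of_fintype, finsum_eq_sum_of_fintype, map_sum]
  refine Finset.sum_congr rfl fun x _ => ?_
  split_ifs
  · rw [neg_toHom, smul_neg, expQZ_neg]
  · rw [map_zero]

theorem levelSum_prod (a : FiniteBilinearForm A) (b : FiniteBilinearForm B) (j : ℕ) :
    (a.prod b).levelSum j = a.levelSum j * b.levelSum j := by
  have := Fintype.ofFinite A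
  have := Fintype.ofFinite B
  rw [levelSum, levelSum, levelSum, finsum_eq_sum_of_fintype, finsum_eq_sum_of_fintype,
    finsum_eq_sum_of_fintype, Finset.sum_mul_sum, Fintype.sum_prod_type]
  refine Finset.sum_congr rfl fun x _ => Finset.sum_congr rfl fun y _ => ?_
  have : (x, y) ∈ AddCommGroup.primaryComponent (A × B) 2 ↔
      x ∈ AddCommGroup.primaryComponent A 2 ∧ y ∈ AddCommGroup.primaryComponent B 2 := by
    simp only [mem_primaryComponent_iff]
    constructor
    · rintro ⟨n, hn⟩
      exact ⟨⟨n, congrArg Prod.fst hn⟩, ⟨n, congrArg Prod.snd hn⟩⟩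
    · rintro ⟨⟨n, hn⟩, ⟨m, hm⟩⟩
      refine ⟨n + m, Prod.ext ?_ ?_⟩
      · change 2 ^ (n + m) • x = 0
        rw [pow_add, mul_comm, mul_smul, hn, smul_zero]
      · change 2 ^ (n + m) • y = 0
        rw [pow_add, mul_smul, hm, smul_zero]
  by_cases hx : x ∈ AddCommGroup.primaryComponent A 2
  · by_cases hy : y ∈ AddCommGroup.primaryComponent B 2
    · rw [if_pos (this.2 ⟨hx, hy⟩), if_pos hx, if_pos hy, prod_toHom, smul_add, expQZ_add]
    · rw [if_neg fun h => hy (this.1 h).2, if_neg hy, mul_zero]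
  · rw [if_neg fun h => hx (this.1 h).1, if_neg hx, zero_mul]

end

theorem levelSum_form_of_ne_two (c : CyclicBlock) (hc : c.p ≠ 2) (j : ℕ) :
    c.form.levelSum j = 1 := by
  rw [levelSum, finsum_eq_single _ 0]
  · simp [expQZ_zero]
  · intro x hx
    rw [if_neg]
    rintro ⟨n, hn⟩
    exact hx (eq_zero_of_coprime_nsmul
      (((Nat.coprime_primes c.prime Nat.prime_two).2 hc).pow c.k n)
      (ZModModule.char_nsmul_eq_zero _ x) hn)

theorem conj_levelSum_form (c : CyclicBlock) (j : ℕ) (hc : c.p = 2 → c.k ≠ j + 1) :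
    starRingEnd ℂ (c.form.levelSum j) =
      Complex.I ^ (-oddity (j + 1) c) * c.form.levelSum j := by
  by_cases h2 : c.p = 2
  · obtain ⟨p, k, a, hp, hk, ha⟩ := c
    simp only at h2
    subst h2
    have hkj : k ≠ j + 1 := hc rfl
    have hP : ∀ x : ZMod (2 ^ k), x ∈ AddCommGroup.primaryComponent (ZMod (2 ^ k)) 2 := fun x =>
      ⟨k, ZModModule.char_nsmul_eq_zero _ x⟩
    have hsum : (CyclicBlock.mk 2 k a hp hk ha).form.levelSum j =
        ∑ i ∈ Finset.range (2 ^ k),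
          expQZ (((2 ^ j : ℕ) * (a * i ^ 2 / (2 ^ k : ℕ)) : ℚ) : AddCircle (1 : ℚ)) := by
      rw [levelSum, finsum_eq_sum_of_fintype, sum_zmod_eq_sum_range]
      refine Finset.sum_congr rfl fun i _ => ?_
      rw [if_pos (hP _), form_toHom]
      simp only
      rw [← Int.cast_natCast, ← Int.cast_mul, ← Int.cast_mul, zmodFrac_intCast]
      change expQZ (((2 ^ j) • (((a * (i : ℤ) * (i : ℤ) : ℤ) : ℚ) / (2 ^ k : ℕ)) : ℚ) : AddCircle (1 : ℚ)) = _
      congr 2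
      rw [nsmul_eq_mul]
      push_cast
      ring
    -- For `k ≤ j` all terms are `1`. For `k > j + 1` the sum is `2^(j+1)` times the primitive Gauss
    -- sum with denominator `2^(k-j)`.
    rcases lt_or_gt_of_ne hkj with hlt | hgt
    · obtain ⟨r, rfl⟩ := Nat.exists_eq_add_of_le (Nat.le_of_lt_succ hlt)
      rw [oddity_of_le (by simp only; omega), neg_zero, zpow_zero, one_mul, hsum, map_sum]
      refine Finset.sum_congr rfl fun i _ => ?_
      rw [show (((2 ^ (k + r) : ℕ) : ℚ) * (a * (i : ℚ) ^ 2 / (2 ^ k : ℕ))) =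
        ((2 ^ r * a * i ^ 2 : ℤ) : ℚ) by push_cast; field_simp; ring, expQZ_ratCast_int, map_one]
    · obtain ⟨m, rfl⟩ := Nat.exists_eq_add_of_lt hgt
      rw [oddity_of_lt rfl hgt]
      have hterm : (CyclicBlock.mk 2 (j + 1 + m + 1) a hp hk ha).form.levelSum j =
          2 ^ (j + 1) * ∑ x ∈ Finset.range (2 ^ (m + 1)), gaussTerm a (m + 1) x := by
        rw [hsum, ← sum_gaussTerm_two_pow_add _ _ _ (by omega),
          show m + 1 + (j + 1) = j + 1 + m + 1 by omega]
        refine Finset.sum_congr rfl fun i _ => ?_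
        rw [gaussTerm]
        congr 2
        push_cast
        field_simp
        ring
      rw [hterm, map_mul, conj_sum_gaussTerm_eq a ha, map_pow, map_ofNat]
      ring
  · rw [levelSum_form_of_ne_two c h2, oddity_of_ne h2]
    simp

/-- Level sums are multiplicative on orthogonal sums, so the phases `i^(-a)` of the blocks multiply;
the even part has a real sum because it is anti-isometric. -/
theorem HasBlocks.conj_levelSum (j : ℕ) : ∀ {L : List CyclicBlock},
    (∀ c ∈ L, c.p = 2 → c.k ≠ j + 1) →
    ∀ {D : Type u} [AddCommGroup D] [Finite D] {b : FiniteBilinearForm D}, HasBlocks L b →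
      starRingEnd ℂ (b.levelSum j) = Complex.I ^ (-totalOddity L (j + 1)) * b.levelSum j
  | [], _, _, _, _, b, ⟨_, _, h⟩ => by
    rw [← levelSum_neg, ← levelSum_congr h]
    simp [totalOddity]
  | c :: L, hL, _, _, _, b, ⟨A, _, _, a, ha, h⟩ => by
    rw [levelSum_congr h, levelSum_prod, map_mul, conj_levelSum_form c j (hL c (by simp)),
      ha.conj_levelSum j fun d hd => hL d (by simp [hd]), totalOddity_cons, neg_add,
      zpow_add₀ Complex.I_ne_zero]
    ring

theorem HasBlocks.nsmul_toHom_self_eq_zero (k : ℕ) (hk : k ≠ 0) : ∀ {L : List CyclicBlock},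
    (∀ c ∈ L, c.p = 2 → c.k ≠ k) →
    ∀ {D : Type u} [AddCommGroup D] [Finite D] {b : FiniteBilinearForm D}, HasBlocks L b →
      ∀ x : D, 2 ^ k • x = 0 → 2 ^ (k - 1) • b.toHom x x = 0
  | [], _, _, _, _, b, ⟨_, he, _⟩, x, hx =>
    he (k - 1) x (by rwa [Nat.sub_add_cancel (Nat.one_le_iff_ne_zero.2 hk)])
  | c :: L, hL, _, _, _, b, ⟨A, _, _, a, ha, f, hf⟩, x, hx => by
    have hfx : 2 ^ k • f x = 0 := by rw [← map_nsmul, hx, map_zero]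
    rw [hf, prod_toHom, smul_add, ha.nsmul_toHom_self_eq_zero k hk
      (fun d hd => hL d (by simp [hd])) _ (congrArg Prod.snd hfx),
      form_nsmul_toHom_eq_zero c 2 k hk (fun h => hL c (by simp) h.1 h.2) _ _
        (congrArg Prod.fst hfx) (congrArg Prod.fst hfx), add_zero]

section

variable {D : Type*} [AddCommGroup D] [Finite D]

theorem isTypeE_of_forall (b : FiniteBilinearForm D) (k : ℕ+)
    (h : ∀ x : D, 2 ^ (k : ℕ) • x = 0 → 2 ^ ((k : ℕ) - 1) • b.toHom x x = 0) : b.IsTypeE k := by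
  intro u
  induction u using QuotientAddGroup.induction_on with | H x =>
  exact h x x.2

/-- The terms are constant on cosets of the `2^k`-torsion `K`, so the two sums differ by the factor
`|K|` and the normalization; in particular they have the same phase. -/
theorem levelSum_eq_mul_sigSum (b : FiniteBilinearForm D) (k : ℕ+) (h : b.IsTypeE k) :
    ∃ r : ℝ, r ≠ 0 ∧ b.levelSum ((k : ℕ) - 1) = r * b.sigSum k h := by
  classical
  have := Fintype.ofFinite D
  have := Fintype.ofFinite (SigGroup D k)
  set P := AddCommGroup.primaryComponent D 2
  set K := torsionPow P (2 ^ (k : ℕ))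
  have hK : (Nat.card K : ℝ) ≠ 0 := Nat.cast_ne_zero.2 Nat.card_pos.ne'
  have hS : √(Nat.card (SigGroup D k) : ℝ) ≠ 0 :=
    Real.sqrt_ne_zero'.2 (Nat.cast_pos.2 Nat.card_pos)
  refine ⟨Nat.card K * √(Nat.card (SigGroup D k)), mul_ne_zero hK hS, ?_⟩
  have h1 : b.levelSum ((k : ℕ) - 1) =
      ∑ x : P, expQZ (b.sigForm k h (QuotientAddGroup.mk x)) := by
    rw [levelSum, finsum_eq_sum_of_fintype, ← Finset.sum_filter]
    exact Finset.sum_subtype _ (fun x => by simp [P])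
      fun x => expQZ (2 ^ ((k : ℕ) - 1) • b.toHom x x)
  have h2 : ∑ x : P, expQZ (b.sigForm k h (QuotientAddGroup.mk x)) =
      Nat.card K * ∑ u, expQZ (b.sigForm k h u) := by
    refine (Fintype.sum_equiv (AddSubgroup.addGroupEquivQuotientProdAddSubgroup (s := K)) _
      (fun y => expQZ (b.sigForm k h y.1)) fun x => rfl).trans ?_
    rw [Fintype.sum_prod_type]
    simp only [Finset.sum_const, Finset.card_univ, nsmul_eq_mul, ← Finset.mul_sum,
      Nat.card_eq_fintype_card]
    congr!
  have hS' : ((√(Nat.card (SigGroup D k) : ℝ) : ℝ) : ℂ) ≠ 0 := Complex.ofReal_ne_zero.2 hS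
  rw [h1, h2, sigSum, finsum_eq_sum_of_fintype]
  push_cast
  field_simp

theorem stdAddChar_ne_zero (a : ZMod 8) : ZMod.stdAddChar a ≠ (0 : ℂ) := by
  intro h
  have := ZMod.stdAddChar.map_add_eq_mul a (-a)
  rw [h, zero_mul, add_neg_cancel, AddChar.map_zero_eq_one] at this
  exact one_ne_zero this

theorem conj_stdAddChar_eq_self_iff (a : ZMod 8) :
    starRingEnd ℂ (ZMod.stdAddChar a) = ZMod.stdAddChar a ↔ a = 0 ∨ a = 4 := by
  have h : starRingEnd ℂ (ZMod.stdAddChar a) = ZMod.stdAddChar (-a) := by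
    rw [AddChar.map_neg_eq_conj]
  rw [h, ZMod.injective_stdAddChar.eq_iff]
  clear h
  revert a
  decide

/-- `σ_k(b) ∈ {0, 4, ∞}` means that the Gauss sum of level `k` is real unless `σ_k(b) = ∞`. -/
theorem signature_mem_iff (b : FiniteBilinearForm D) (k : ℕ+) :
    b.signature k ∈ ({((0 : ZMod 8) : WithTop (ZMod 8)), ((4 : ZMod 8) : WithTop (ZMod 8)), ⊤} :
      Set (WithTop (ZMod 8))) ↔
    (b.IsTypeE k → b.levelSum ((k : ℕ) - 1) ≠ 0 ∧
      starRingEnd ℂ (b.levelSum ((k : ℕ) - 1)) = b.levelSum ((k : ℕ) - 1)) := by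
  by_cases h : b.IsTypeE k
  · obtain ⟨a, ha⟩ := b.exists_sigSum_eq k h
    have hsig := (b.signature_eq_coe_iff k a).2 ⟨h, ha⟩
    obtain ⟨r, hr, hsum⟩ := b.levelSum_eq_mul_sigSum k h
    have hr' : (r : ℂ) ≠ 0 := Complex.ofReal_ne_zero.2 hr
    have hne := stdAddChar_ne_zero a
    rw [hsig, hsum, ha, map_mul, Complex.conj_ofReal, mul_right_inj' hr',
      conj_stdAddChar_eq_self_iff]
    simp [h, hr', hne]
  · simp [(b.signature_eq_top_iff k).2 h, h]

end

/-- A level without `2`-blocks is alternating, so its level sum is nonzero and real by hypothesis.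
Comparison with `HasBlocks.conj_levelSum` gives `i^(-t) = 1` for the total oddity `t`, that is, `4 ∣
t`. -/
theorem HasBlocks.oddityCondition {D : Type u} [AddCommGroup D] [Finite D]
    {b : FiniteBilinearForm D} {L : List CyclicBlock} (hb : HasBlocks L b)
    (h : ∀ k : ℕ+, b.IsTypeE k → b.levelSum ((k : ℕ) - 1) ≠ 0 ∧
      starRingEnd ℂ (b.levelSum ((k : ℕ) - 1)) = b.levelSum ((k : ℕ) - 1)) :
    OddityCondition L := by
  intro j hj hL
  obtain ⟨j, rfl⟩ := Nat.exists_eq_succ_of_ne_zero hj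
  obtain ⟨h0, h1⟩ := h ⟨j + 1, j.succ_pos⟩
    (b.isTypeE_of_forall _ (hb.nsmul_toHom_self_eq_zero (j + 1) j.succ_ne_zero hL))
  simp only [PNat.mk_coe, Nat.add_sub_cancel] at h0 h1
  rw [hb.conj_levelSum j hL] at h1
  have h2 := mul_right_cancel₀ h0 (h1.trans (one_mul _).symm)
  rw [← dvd_neg]
  have h3 : (-totalOddity L (j + 1)) = (-totalOddity L (j + 1)) % 4 +
    4 * ((-totalOddity L (j + 1)) / 4) := (Int.emod_add_mul_ediv _ _).symm
  rw [h3, zpow_add₀ Complex.I_ne_zero, zpow_mul] at h2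
  have h4 : Complex.I ^ (4 : ℤ) = 1 := by
    rw [show (4 : ℤ) = ((4 : ℕ) : ℤ) by rfl, zpow_natCast, Complex.I_pow_four]
  rw [h4, one_zpow, mul_one] at h2
  have h5 := Int.emod_nonneg (-totalOddity L (j + 1)) four_ne_zero
  have h6 := Int.emod_lt_of_pos (-totalOddity L (j + 1)) four_pos
  rw [Int.dvd_iff_emod_eq_zero]
  generalize (-totalOddity L (j + 1)) % 4 = r at h2 h5 h6
  interval_cases r
  · rfl
  · rw [zpow_one] at h2
    exact absurd (congrArg Complex.re h2) (by simp)
  · rw [show (2 : ℤ) = ((2 : ℕ) : ℤ) by rfl, zpow_natCast, Complex.I_sq] at h2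
    exact absurd (congrArg Complex.re h2) (by norm_num)
  · rw [show (3 : ℤ) = ((3 : ℕ) : ℤ) by rfl, zpow_natCast, Complex.I_pow_three] at h2
    exact absurd (congrArg Complex.re h2) (by simp)

end FiniteBilinearForm

/-! ### The criterion for anti-isometry -/

theorem mainTheorem2 {D : Type*} [AddCommGroup D] [Finite D] (b : FiniteBilinearForm D) :
    b.Isometric (-b) ↔
      (∀ (p : ℕ) [Fact p.Prime], p % 4 = 3 → ∀ k : ℕ, 1 ≤ k → Even (homogeneousRank D p k)) ∧
      (∀ k : ℕ+, b.signature k ∈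
        ({((0 : ZMod 8) : WithTop (ZMod 8)), ((4 : ZMod 8) : WithTop (ZMod 8)), ⊤} :
          Set (WithTop (ZMod 8)))) := by
  obtain ⟨L, hL⟩ := FiniteBilinearForm.exists_hasBlocks _ b rfl
  constructor
  · intro h
    refine ⟨fun p _ hp k hk => ?_, fun k => (b.signature_mem_iff k).2 fun hE => ⟨?_, ?_⟩⟩
    · rw [hL.homogeneousRank_eq p (by omega) k hk]
      exact hL.even_blockRank p k hp (by omega) h
    · obtain ⟨r, hr, hsum⟩ := b.levelSum_eq_mul_sigSum k hE
      obtain ⟨a, ha⟩ := b.exists_sigSum_eq k hE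
      rw [hsum, ha]
      exact mul_ne_zero (Complex.ofReal_ne_zero.2 hr) (FiniteBilinearForm.stdAddChar_ne_zero a)
    · rw [← FiniteBilinearForm.levelSum_neg, ← FiniteBilinearForm.levelSum_congr h]
  · rintro ⟨hpar, hsig⟩
    refine hL.antiIsometric _ L rfl (fun p k hp => ?_)
      (hL.oddityCondition fun k => (b.signature_mem_iff k).1 (hsig k))
    -- The parity condition ranges over all natural numbers `p` and `k`; a nonzero count comes from
    -- an actual block, which makes `p` prime and `k ≥ 1`.
    rcases Nat.eq_zero_or_pos (CyclicBlock.blockRank L p k) with h0 | h0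
    · rw [h0]; exact Even.zero
    · obtain ⟨c, -, hc⟩ := List.countP_pos_iff.1 h0
      obtain ⟨rfl, rfl⟩ := of_decide_eq_true hc
      have : Fact c.p.Prime := ⟨c.prime⟩
      rw [← hL.homogeneousRank_eq c.p (by omega) c.k (Nat.one_le_iff_ne_zero.2 c.k_ne_zero)]
      exact hpar c.p hp c.k (Nat.one_le_iff_ne_zero.2 c.k_ne_zero)
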